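/- Let $R$ be an associative unital ring, not necessarily commutative, and let $L = R[x,x^{-1},y,y^{-1}]$ be the Laurent polynomial ring in two variables which commute with each other and with the elements of $R$. Modules are unital right modules, and cochain complexes are indexed by $\mathbb{Z}$. For a ring $S$ write $S((z)) = S[[z]][z^{-1}]$ for the ring of formal Laurent series $\sum_{i \ge k} s_i z^i$ ($k \in \mathbb{Z}$, $s_i \in S$), where $z$ commutes with $S$. For signs $\varepsilon, \delta \in \{1,-1\}$ write $R((x^{\varepsilon}, y^{\delta})) = R[[x^{\varepsilon}, y^{\delta}]][(x^{\varepsilon}y^{\delta})^{-1}]$ for the ring of formal Laurent series $\sum_{p,q \ge k} a_{p,q}\, x^{\varepsilon p} y^{\delta q}$ ($k \in \mathbb{Z}$, $a_{p,q} \in R$). All these rings contain $L$, and are regarded as left $L$-modules by multiplication. Let $C$ be a bounded cochain complex of finitely generated free $L$-modules. Then the following two statements are equivalent: (a) The complex $C$ is $R$-finitely dominated, i.e., $C$ is homotopy equivalent, as a cochain complex of $R$-modules, to a bounded cochain complex of finitely generated projective $R$-modules. (b) The following eight cochain complexes are acyclic: $$C \otimes_L R[x,x^{-1}]((y)), \quad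 C \otimes_L R[x,x^{-1}]((y^{-1})), \quad C \otimes_L R[y,y^{-1}]((x)), \quad C \otimes_L R[y,y^{-1}]((x^{-1})),$$ $$C \otimes_L R((x,y)), \quad C \otimes_L R((x^{-1},y^{-1})), \quad C \otimes_L R((x,y^{-1})), \quad C \otimes_L R((x^{-1},y)).$$ -/

import Mathlib

open CategoryTheory
open scoped TensorProduct

universe u

noncomputable section

/-! Right modules over a (possibly non-commutative) ring `A` are modules over `Aᵐᵒᵖ`:
the element `MulOpposite.op a • m` is `m · a`. -/

section Tensor

variable {A : Type u} [Ring A]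

/-- The subgroup of `M ⊗_ℤ N` generated by the elements `(m · a) ⊗ n - m ⊗ (a · n)`,
for a right `A`-module `M` and a left `A`-module `N`. -/
def balancedRelations (M : Type u) [AddCommGroup M] [Module Aᵐᵒᵖ M]
    (N : Type u) [AddCommGroup N] [Module A N] : Submodule ℤ (M ⊗[ℤ] N) :=
  Submodule.span ℤ {t | ∃ (m : M) (a : A) (n : N),
    t = (MulOpposite.op a • m) ⊗ₜ[ℤ] n - m ⊗ₜ[ℤ] (a • n)}

lemma balancedRelations_le_comap {M M' : Type u} [AddCommGroup M] [Module Aᵐᵒᵖ M]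
    [AddCommGroup M'] [Module Aᵐᵒᵖ M'] (N : Type u) [AddCommGroup N] [Module A N]
    (f : M →ₗ[Aᵐᵒᵖ] M') :
    balancedRelations (A := A) M N ≤
      (balancedRelations (A := A) M' N).comap
        (f.toAddMonoidHom.toIntLinearMap.rTensor N) := by
  refine Submodule.span_le.2 ?_
  rintro _ ⟨m, a, n, rfl⟩
  refine Submodule.subset_span ⟨f m, a, n, ?_⟩
  simp

/-- The functor `M ↦ M ⊗_A N` from right `A`-modules to abelian groups,
for a left `A`-module `N`. -/
def tensorFunctor (N : ModuleCat.{u} A) : ModuleCat.{u} Aᵐᵒᵖ ⥤ ModuleCat.{u} ℤ where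
  obj M := ModuleCat.of ℤ ((M ⊗[ℤ] N) ⧸ balancedRelations (A := A) M N)
  map {M M'} f := ModuleCat.ofHom
    (Submodule.mapQ (balancedRelations (A := A) M N) (balancedRelations (A := A) M' N)
      (f.hom.toAddMonoidHom.toIntLinearMap.rTensor N)
      (balancedRelations_le_comap N f.hom))
  map_id M := by
    ext : 1
    refine Submodule.linearMap_qext _ (TensorProduct.ext' fun m n => ?_)
    rfl
  map_comp f g := by
    ext : 1
    refine Submodule.linearMap_qext _ (TensorProduct.ext' fun m n => ?_)
    rfl

instance (N : ModuleCat.{u} A) : (tensorFunctor N).Additive where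
  map_add {M M' f g} := by
    ext : 1
    refine Submodule.linearMap_qext _ (TensorProduct.ext' fun m n => ?_)
    change Submodule.Quotient.mk ((f.hom m + g.hom m) ⊗ₜ[ℤ] n) = _
    rw [TensorProduct.add_tmul]
    rfl

/-- The cochain complex `C ⊗_A S` of abelian groups, where the ring `S` is a left `A`-module
through the ring homomorphism `φ : A → S`. -/
def tensorComplex {S : Type u} [Ring S] (φ : A →+* S)
    (C : CochainComplex (ModuleCat.{u} Aᵐᵒᵖ) ℤ) : CochainComplex (ModuleCat.{u} ℤ) ℤ :=
  ((tensorFunctor ((ModuleCat.restrictScalars φ).obj (ModuleCat.of S S))).mapHomologicalComplex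
    (ComplexShape.up ℤ)).obj C

end Tensor

section FiniteDomination

/-- A cochain complex is bounded if it vanishes outside a finite range of degrees. -/
def IsBoundedComplex {A : Type u} [Ring A] (C : CochainComplex (ModuleCat.{u} A) ℤ) : Prop :=
  ∃ a b : ℤ, C.IsStrictlyGE a ∧ C.IsStrictlyLE b

/-- A cochain complex `C` of right `A`-modules is `R`-finitely dominated, for a ring homomorphism
`ι : R → A`, if it is homotopy equivalent, as a complex of right `R`-modules, to a bounded complex
of finitely generated projective right `R`-modules. -/
def IsFinitelyDominated {R A : Type u} [Ring R] [Ring A] (ι : R →+* A)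
    (C : CochainComplex (ModuleCat.{u} Aᵐᵒᵖ) ℤ) : Prop :=
  ∃ B : CochainComplex (ModuleCat.{u} Rᵐᵒᵖ) ℤ,
    IsBoundedComplex B ∧
    (∀ n, Module.Finite Rᵐᵒᵖ (B.X n) ∧ Module.Projective Rᵐᵒᵖ (B.X n)) ∧
    Nonempty (HomotopyEquiv
      (((ModuleCat.restrictScalars (RingHom.op ι)).mapHomologicalComplex
        (ComplexShape.up ℤ)).obj C) B)

end FiniteDomination

section Rings

variable (R : Type u) [Ring R]

/-- The Laurent polynomial ring `L = R[x, x⁻¹, y, y⁻¹]`; the monomial `r x^p y^q` is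
`AddMonoidAlgebra.single (p, q) r`. The variables commute with each other and with `R`. -/
abbrev LaurentPoly₂ : Type u := AddMonoidAlgebra R (ℤ × ℤ)

/-- The ring `R((s, t)) = R[[s, t]][(s t)⁻¹]` of formal Laurent series in two variables whose
support is contained in `{(p, q) | p ≥ k, q ≥ k}` for some `k`. For the componentwise order on
`ℤ × ℤ` these are precisely the Hahn series, see `isPWO_support_iff`. -/
abbrev Novikov₂ : Type u := HahnSeries (ℤ × ℤ) R

/-- The ring `R[s, s⁻¹]((t))` of formal Laurent series in `t` over `R[s, s⁻¹]`. -/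
abbrev EdgeNovikov : Type u := LaurentSeries (LaurentPolynomial R)

variable {R}

lemma isPWO_support_iff (f : ℤ × ℤ → R) :
    (Function.support f).IsPWO ↔ ∃ k : ℤ, ∀ p q : ℤ, f (p, q) ≠ 0 → k ≤ p ∧ k ≤ q := by
  constructor
  · intro h
    have hf := (h.image_of_monotone monotone_fst).isWF
    have hs := (h.image_of_monotone monotone_snd).isWF
    obtain ⟨a, ha⟩ : BddBelow (Prod.fst '' Function.support f) := by
      rcases (Prod.fst '' Function.support f).eq_empty_or_nonempty with h0 | h0
      · simp [h0]
      · exact ⟨hf.min h0, fun b hb => hf.min_le h0 hb⟩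
    obtain ⟨b, hb⟩ : BddBelow (Prod.snd '' Function.support f) := by
      rcases (Prod.snd '' Function.support f).eq_empty_or_nonempty with h0 | h0
      · simp [h0]
      · exact ⟨hs.min h0, fun b hb => hs.min_le h0 hb⟩
    refine ⟨min a b, fun p q hpq => ⟨?_, ?_⟩⟩
    · exact (min_le_left _ _).trans (ha ⟨(p, q), hpq, rfl⟩)
    · exact (min_le_right _ _).trans (hb ⟨(p, q), hpq, rfl⟩)
  · rintro ⟨k, hk⟩
    have hI : (Set.Ici k).IsPWO := by
      rw [Set.isPWO_iff_isWF]
      exact BddBelow.isWF ⟨k, fun _ h => h⟩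
    exact (hI.prod hI).mono fun x hx => hk x.1 x.2 hx

variable (R)

/-- The inclusion `L → R((x^ε, y^δ))` for signs `ε, δ`. The target is `R((s, t))` with
`s = x^ε` and `t = y^δ`, so that `r x^p y^q` is sent to `r s^(ε p) t^(δ q)`. -/
def vertexHom (ε δ : ℤˣ) : LaurentPoly₂ R →+* Novikov₂ R :=
  AddMonoidAlgebra.liftNCRingHom (HahnSeries.C : R →+* Novikov₂ R)
    { toFun := fun g => HahnSeries.single
        ((ε : ℤ) * g.toAdd.1, (δ : ℤ) * g.toAdd.2) (1 : R)
      map_one' := by simp; rfl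
      map_mul' := fun g h => by
        simp [HahnSeries.single_mul_single, mul_add] }
    (fun r g => by
      simp [Commute, SemiconjBy, HahnSeries.C_apply, HahnSeries.single_mul_single])

/-- The inclusion `L → R[x, x⁻¹]((y^δ))` for a sign `δ`. The target is `R[s, s⁻¹]((t))` with
`s = x` and `t = y^δ`, so that `r x^p y^q` is sent to `r s^p t^(δ q)`. -/
def edgeHomY (δ : ℤˣ) : LaurentPoly₂ R →+* EdgeNovikov R :=
  AddMonoidAlgebra.liftNCRingHom
    ((HahnSeries.C : LaurentPolynomial R →+* EdgeNovikov R).comp LaurentPolynomial.C)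
    { toFun := fun g => HahnSeries.single ((δ : ℤ) * g.toAdd.2)
        (LaurentPolynomial.T g.toAdd.1 : LaurentPolynomial R)
      map_one' := by simp
      map_mul' := fun g h => by
        rw [HahnSeries.single_mul_single, ← LaurentPolynomial.T_add, ← mul_add]
        rfl }
    (fun r g => by
      simp [Commute, SemiconjBy, HahnSeries.C_apply, HahnSeries.single_mul_single])

/-- The inclusion `L → R[y, y⁻¹]((x^ε))` for a sign `ε`. The target is `R[s, s⁻¹]((t))` with
`s = y` and `t = x^ε`, so that `r x^p y^q` is sent to `r s^q t^(ε p)`. -/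
def edgeHomX (ε : ℤˣ) : LaurentPoly₂ R →+* EdgeNovikov R :=
  AddMonoidAlgebra.liftNCRingHom
    ((HahnSeries.C : LaurentPolynomial R →+* EdgeNovikov R).comp LaurentPolynomial.C)
    { toFun := fun g => HahnSeries.single ((ε : ℤ) * g.toAdd.1)
        (LaurentPolynomial.T g.toAdd.2 : LaurentPolynomial R)
      map_one' := by simp
      map_mul' := fun g h => by
        rw [HahnSeries.single_mul_single, ← LaurentPolynomial.T_add, ← mul_add]
        rfl }
    (fun r g => by
      simp [Commute, SemiconjBy, HahnSeries.C_apply, HahnSeries.single_mul_single])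

end Rings

end

/-! Bases turn `C` into a square matrix `D` over `L` with `D * D = 0`, and `C ⊗ S` is acyclic
exactly when `D` is exact on vectors over `S`. Both statements are compared with exactness over the
thin rings `R((y))[x, x⁻¹]`, taken in various coordinates on `ℤ × ℤ`, and with the existence of an
`R`-linear `H` such that all values of `1 - D H - H D` have their support in one finite set.

If `C` is finitely dominated, such an `H` exists. Its conjugates by powers of `y` allow a thin cycle
to be written as a boundary height by height, so `D` is exact over every thin ring. As an exact
bounded complex of free modules is contractible, exactness passes along ring homomorphisms. After a
change of signs, an exchange of the variables or a shear, the thin rings map to the eight rings.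

Conversely, `R((y))[x, x⁻¹]` is the intersection of `R((x, y))` and `R((x⁻¹, y))`, and the sum of
these two inside the formal series consists of the series bounded below in `y`, which form a module
over `R[x, x⁻¹]((y))`. So exactness over the three rings gives exactness over the thin one. Apply a
contraction over `R((y⁻¹))[x, x⁻¹]` to Laurent polynomials and keep the coefficients at heights
`≥ 0`, which are finite in number; take those at negative heights from a contraction over
`R((y))[x, x⁻¹]`. The resulting `R`-linear `σ` fails to be a contraction only near height `0`: the
values of `1 - D σ - σ D` are supported in a horizontal strip. For `τ` constructed likewise with the
variables exchanged, `H = τ + (1 - D τ - τ D) σ` has defect `(1 - D τ - τ D) (1 - D σ - σ D)`, with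
values supported in a bounded rectangle.

Given such an `H`, which may be taken of degree `-1`, a finitely generated free graded module `F` of
Laurent polynomials, stable under `D`, contains these values. Polynomials with coefficients in `F`,
in a variable `u` of degree `-1` for which multiplication by `u` is a homotopy from the identity to
`w ↦ (1 - D H - H D) w(H)`, then form a complex homotopy equivalent to `C`. It is bounded above and
finitely generated projective in each degree. As `C` vanishes in low degrees, its truncation splits
off by an idempotent. -/

noncomputable section

open Matrix.Module

section Exactness

variable {T : Type*} [Fintype T]

/-- `D` is the differential of a graded module with homogeneous basis `T`: it squares to zero and
raises the degree by one. -/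
structure IsGradedDifferential {A : Type*} [Ring A] (deg : T → ℤ) (D : Matrix T T A) : Prop where
  mul_self : D * D = 0
  deg_eq : ∀ {s t}, D s t ≠ 0 → deg s = deg t + 1

lemma IsGradedDifferential.map {A S : Type*} [Ring A] [Ring S] {deg : T → ℤ}
    {D : Matrix T T A} (hD : IsGradedDifferential deg D) (φ : A →+* S) :
    IsGradedDifferential deg (D.map φ) where
  mul_self := by rw [← Matrix.map_mul, hD.mul_self, Matrix.map_zero _ (map_zero φ)]
  deg_eq {s t} h := hD.deg_eq fun h0 => h (by rw [Matrix.map_apply, h0, map_zero])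

variable [DecidableEq T]

/-- The matrix `D`, acting on vectors with entries in the submodule `M`, has vanishing homology. -/
def IsExactOn {A N : Type*} [Ring A] [AddCommGroup N] [Module A N] (D : Matrix T T A)
    (M : Submodule A N) : Prop :=
  ∀ v : T → N, (∀ t, v t ∈ M) → D • v = 0 → ∃ w : T → N, (∀ t, w t ∈ M) ∧ D • w = v

/-- The matrix `D`, acting on vectors over the ring `S` through `φ`, has vanishing homology. -/
def IsExactOver {A S : Type*} [Ring A] [Ring S] (φ : A →+* S) (D : Matrix T T A) : Prop :=
  IsExactOn (D.map φ) (⊤ : Submodule S S)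

lemma isExactOver_iff {A S : Type*} [Ring A] [Ring S] {φ : A →+* S} {D : Matrix T T A} :
    IsExactOver φ D ↔ ∀ v : T → S, D.map φ • v = 0 → ∃ w : T → S, D.map φ • w = v := by
  simp [IsExactOver, IsExactOn]

lemma isExactOver_comp_iff {A B S : Type*} [Ring A] [Ring B] [Ring S] {φ : A →+* B} {ψ : B →+* S}
    {D : Matrix T T A} : IsExactOver (ψ.comp φ) D ↔ IsExactOver ψ (D.map φ) :=
  Iff.rfl

lemma matrix_smul_mem {A N : Type*} [Ring A] [AddCommGroup N] [Module A N] (D : Matrix T T A)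
    {M : Submodule A N} {v : T → N} (hv : ∀ t, v t ∈ M) (s : T) : (D • v) s ∈ M :=
  M.sum_mem fun t _ => M.smul_mem _ (hv t)

lemma map_smul_comp {A S N F : Type*} [Ring A] [Ring S] [AddCommGroup N] [Module S N]
    [AddCommGroup F] [Module A F] {φ : A →+* S} {c : N →+ F} (hc : ∀ a n, c (φ a • n) = a • c n)
    (D : Matrix T T A) (v : T → N) : D • (c ∘ v) = c ∘ (D.map φ • v) := by
  ext s
  simp [hc]

lemma isExactOn_iff_of_range_eq {A S N F : Type*} [Ring A] [Ring S] [AddCommGroup N] [Module S N]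
    [AddCommGroup F] [Module A F] {φ : A →+* S} {c : N →+ F} (hc : ∀ a n, c (φ a • n) = a • c n)
    (hinj : Function.Injective c) {M : Submodule A F} (hM : Set.range c = M) (D : Matrix T T A) :
    IsExactOn (D.map φ) (⊤ : Submodule S N) ↔ IsExactOn D M := by
  have mem_iff (f : F) : f ∈ M ↔ ∃ n, c n = f := by rw [← SetLike.mem_coe, ← hM, Set.mem_range]
  constructor
  · intro h v hv hDv
    choose v' hv' using fun t => (mem_iff _).1 (hv t)
    obtain rfl : c ∘ v' = v := funext hv'
    rw [map_smul_comp hc] at hDv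
    obtain ⟨w, -, hw⟩ := h v' (fun _ => trivial)
      (funext fun t => hinj ((congrFun hDv t).trans (map_zero c).symm))
    exact ⟨c ∘ w, fun t => (mem_iff _).2 ⟨w t, rfl⟩, by rw [map_smul_comp hc, hw]⟩
  · intro h v _ hDv
    obtain ⟨w, hwM, hw⟩ := h (c ∘ v) (fun t => (mem_iff _).2 ⟨v t, rfl⟩) (by
      rw [map_smul_comp hc, hDv]
      exact funext fun _ => map_zero c)
    choose w' hw' using fun t => (mem_iff _).1 (hwM t)
    obtain rfl : c ∘ w' = w := funext hw'
    rw [map_smul_comp hc] at hw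
    exact ⟨w', fun _ => trivial, funext fun t => hinj (congrFun hw t)⟩

lemma IsExactOn.inf {A N : Type*} [Ring A] [AddCommGroup N] [Module A N] {D : Matrix T T A}
    (hD : D * D = 0) {M₁ M₂ : Submodule A N} (h₁ : IsExactOn D M₁) (h₂ : IsExactOn D M₂)
    (h : IsExactOn D (M₁ ⊔ M₂)) : IsExactOn D (M₁ ⊓ M₂) := by
  intro v hv hDv
  obtain ⟨w₁, hw₁, rfl⟩ := h₁ v (fun t => (hv t).1) hDv
  obtain ⟨w₂, hw₂, hw⟩ := h₂ _ (fun t => (hv t).2) hDv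
  obtain ⟨u, hu, hDu⟩ := h (w₁ - w₂)
    (fun t => sub_mem (Submodule.mem_sup_left (hw₁ t)) (Submodule.mem_sup_right (hw₂ t)))
    (by rw [smul_sub, hw, sub_self])
  choose u₁ hu₁ u₂ hu₂ hu using fun t => Submodule.mem_sup.1 (hu t)
  obtain rfl : u₁ + u₂ = u := funext hu
  have heq : w₁ - D • u₁ = w₂ + D • u₂ := by
    rw [sub_eq_iff_eq_add, add_assoc, add_comm (D • u₂), ← smul_add, hDu, add_sub_cancel]
  refine ⟨w₁ - D • u₁, fun t => ⟨sub_mem (hw₁ t) (matrix_smul_mem D hu₁ t), ?_⟩, ?_⟩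
  · rw [heq]
    exact add_mem (hw₂ t) (matrix_smul_mem D hu₂ t)
  · rw [heq, smul_add, hw, smul_smul, hD, zero_smul, add_zero]

lemma smul_add_smul_of_contraction {S N : Type*} [Ring S] [AddCommGroup N] [Module S N]
    {D s : Matrix T T S} (h : D * s + s * D = 1) (v : T → N) : D • s • v + s • D • v = v := by
  rw [smul_smul, smul_smul, ← add_smul, h, one_smul]

lemma IsExactOn.of_contraction {S N : Type*} [Ring S] [AddCommGroup N] [Module S N]
    {D s : Matrix T T S} (h : D * s + s * D = 1) (M : Submodule S N) : IsExactOn D M :=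
  fun v hv hDv => ⟨s • v, matrix_smul_mem s hv, by
    simpa only [hDv, smul_zero, add_zero] using smul_add_smul_of_contraction h v⟩

namespace IsGradedDifferential

variable {S : Type*} [Ring S] {deg : T → ℤ} {D : Matrix T T S} (hD : IsGradedDifferential deg D)
include hD

lemma exists_contraction_step (hex : IsExactOn D (⊤ : Submodule S S)) {n : ℤ} {s : Matrix T T S}
    (hs : ∀ t, n < deg t → ∀ r, (D * s + s * D) r t = (1 : Matrix T T S) r t) :
    ∃ s' : Matrix T T S, ∀ t, n ≤ deg t → ∀ r, (D * s' + s' * D) r t = (1 : Matrix T T S) r t := by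
  have mul_congr {X Y : Matrix T T S} {t : T}
      (hXY : ∀ r q, deg q = deg t + 1 → X r q = Y r q) (r : T) : (X * D) r t = (Y * D) r t := by
    rw [Matrix.mul_apply, Matrix.mul_apply]
    refine Finset.sum_congr rfl fun q _ => ?_
    by_cases hq : D q t = 0
    · rw [hq, mul_zero, mul_zero]
    · rw [hXY r q (hD.deg_eq hq)]
  have exists_column (t : T) (ht : n ≤ deg t) : ∃ w : T → S, D • w = (1 - s * D).col t := by
    have hcycle : D * (1 - s * D) = (1 - (D * s + s * D)) * D := by
      rw [mul_sub, sub_mul, add_mul, mul_assoc s, hD.mul_self, mul_zero, mul_one, one_mul,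
        add_zero, mul_assoc]
    obtain ⟨w, -, hw⟩ := hex _ (fun _ => trivial) (funext fun r =>
      show (D * (1 - s * D)) r t = 0 from by
        rw [hcycle, mul_congr (Y := 0), zero_mul, Matrix.zero_apply]
        intro r q hq
        rw [Matrix.sub_apply, hs q (by omega), sub_self, Matrix.zero_apply])
    exact ⟨w, hw⟩
  choose! w hw using exists_column
  refine ⟨Matrix.of fun r t => if deg t = n then w t r else s r t, fun t ht r => ?_⟩
  rw [Matrix.add_apply, mul_congr (Y := s) fun r q hq => by
    rw [Matrix.of_apply, if_neg (by omega)]]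
  obtain hn | hn := ht.eq_or_lt
  · have : (D * Matrix.of fun r t => if deg t = n then w t r else s r t) r t = (D • w t) r := by
      simp [Matrix.mul_apply, hn]
    rw [this, hw t ht, Matrix.col_apply, Matrix.sub_apply, sub_add_cancel]
  · rw [← hs t hn r, Matrix.add_apply]
    simp [Matrix.mul_apply, hn.ne']

lemma exists_contraction (hex : IsExactOn D (⊤ : Submodule S S)) :
    ∃ s : Matrix T T S, D * s + s * D = 1 := by
  obtain ⟨a, ha⟩ := (Set.finite_range deg).bddBelow
  obtain ⟨b, hb⟩ := (Set.finite_range deg).bddAbove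
  have partial_contraction (n : ℕ) : ∃ s : Matrix T T S, ∀ t, b - n < deg t →
      ∀ r, (D * s + s * D) r t = (1 : Matrix T T S) r t := by
    induction n with
    | zero => exact ⟨0, fun t ht => absurd (hb ⟨t, rfl⟩) (by simpa using ht)⟩
    | succ n ih =>
      obtain ⟨s, hs⟩ := ih
      obtain ⟨s', hs'⟩ := hD.exists_contraction_step hex hs
      exact ⟨s', fun t ht => hs' t (by push_cast at ht; omega)⟩
  obtain ⟨s, hs⟩ := partial_contraction (b - a + 1).toNat
  refine ⟨s, Matrix.ext fun r t => hs t ?_ r⟩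
  have := ha ⟨t, rfl⟩
  omega

end IsGradedDifferential

lemma IsExactOver.comp {A B S : Type*} [Ring A] [Ring B] [Ring S] {φ : A →+* B}
    {deg : T → ℤ} {D : Matrix T T A} (hD : IsGradedDifferential deg D) (h : IsExactOver φ D)
    (ψ : B →+* S) : IsExactOver (ψ.comp φ) D := by
  obtain ⟨s, hs⟩ := (hD.map φ).exists_contraction h
  refine IsExactOn.of_contraction (s := s.map ψ) ?_ ⊤
  rw [RingHom.coe_comp, ← Matrix.map_map, ← Matrix.map_mul, ← Matrix.map_mul,
    ← Matrix.map_add _ (map_add ψ), hs, Matrix.map_one _ (map_zero ψ) (map_one ψ)]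

end Exactness

section FormalSeries

/-- Two-sided formal power series: arbitrary functions on `G`, thought of as infinite sums
`∑ g, f g • g`. They cannot be multiplied, but the group algebra acts on them by convolution. -/
def FormalSeries (R G : Type*) : Type _ := G → R

namespace FormalSeries

variable {R G : Type*}

@[ext] lemma ext {f f' : FormalSeries R G} (h : ∀ g, f g = f' g) : f = f' := funext h

variable [Ring R]

instance : AddCommGroup (FormalSeries R G) := inferInstanceAs (AddCommGroup (G → R))

instance : Module R (FormalSeries R G) := inferInstanceAs (Module R (G → R))

instance : Module Rᵐᵒᵖ (FormalSeries R G) := inferInstanceAs (Module Rᵐᵒᵖ (G → R))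

lemma add_apply (f f' : FormalSeries R G) (g : G) : (f + f') g = f g + f' g := rfl

lemma sub_apply (f f' : FormalSeries R G) (g : G) : (f - f') g = f g - f' g := rfl

/-- Evaluation of a formal series at `g`, that is, its coefficient at the monomial `g`. -/
def coeffHom (g : G) : FormalSeries R G →ₗ[Rᵐᵒᵖ] R := LinearMap.proj g

lemma sum_apply {ι : Type*} (s : Finset ι) (f : ι → FormalSeries R G) (g : G) :
    (∑ i ∈ s, f i) g = ∑ i ∈ s, f i g :=
  map_sum (coeffHom g) f s

variable [AddCommGroup G]

/-- Translation `f ↦ f (· - g)`, the action of the monomial `g`. -/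
def shift (g : G) : AddMonoid.End (FormalSeries R G) where
  toFun f k := f (k - g)
  map_zero' := rfl
  map_add' _ _ := rfl

/-- The convolution action of the group algebra on formal series. -/
def convolution : AddMonoidAlgebra R G →+* AddMonoid.End (FormalSeries R G) :=
  AddMonoidAlgebra.liftNCRingHom (Module.toAddMonoidEnd R (FormalSeries R G))
    { toFun := fun g => shift g.toAdd
      map_one' := AddMonoidHom.ext fun f => ext fun k => congrArg f (sub_zero k)
      map_mul' := fun g h => AddMonoidHom.ext fun f => ext fun k =>
        congrArg f (sub_add_eq_sub_sub k g.toAdd h.toAdd) }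
    (fun _ _ => rfl)

instance : Module (AddMonoidAlgebra R G) (FormalSeries R G) :=
  Module.compHom (FormalSeries R G) (convolution (R := R) (G := G))

lemma single_smul_apply (g : G) (r : R) (f : FormalSeries R G) (k : G) :
    (AddMonoidAlgebra.single g r • f) k = r * f (k - g) := by
  have h : convolution (AddMonoidAlgebra.single g r)
      = Module.toAddMonoidEnd R (FormalSeries R G) r * shift g :=
    AddMonoidAlgebra.liftNC_single _ _ _ _
  exact congrFun (DFunLike.congr_fun h f) k

end FormalSeries

variable {R G : Type*} [Ring R]

lemma eq_sum_single (l : AddMonoidAlgebra R G) :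
    l = ∑ g ∈ l.coeff.support, AddMonoidAlgebra.single g (l.coeff g) :=
  (AddMonoidAlgebra.sum_coeff_single l).symm

variable [AddCommGroup G]

lemma map_smul_of_single {S N N' : Type*} [Ring S] [AddCommGroup N] [AddCommGroup N'] [Module S N]
    [Module (AddMonoidAlgebra R G) N'] {φ : AddMonoidAlgebra R G →+* S} {c : N →+ N'}
    (hc : ∀ g r n, c (φ (.single g r) • n) = (AddMonoidAlgebra.single g r) • c n)
    (l : AddMonoidAlgebra R G) (n : N) : c (φ l • n) = l • c n := by
  rw [eq_sum_single l, map_sum, Finset.sum_smul, Finset.sum_smul, map_sum]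
  exact Finset.sum_congr rfl fun g _ => hc g _ n

namespace FormalSeries

lemma smul_apply (l : AddMonoidAlgebra R G) (f : FormalSeries R G) (k : G) :
    (l • f) k = ∑ g ∈ l.coeff.support, l.coeff g * f (k - g) := by
  conv_lhs => rw [eq_sum_single l, Finset.sum_smul, sum_apply]
  simp only [single_smul_apply]

/-- A Laurent polynomial as a formal series. -/
def ofLaurent : AddMonoidAlgebra R G →ₗ[AddMonoidAlgebra R G] FormalSeries R G :=
  let c : AddMonoidAlgebra R G →+ FormalSeries R G :=
    { toFun := fun l g => l.coeff g
      map_zero' := rfl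
      map_add' := fun _ _ => rfl }
  { c with
    map_smul' := map_smul_of_single (φ := RingHom.id (AddMonoidAlgebra R G)) (c := c)
      fun g r n => ext fun k => by
        rw [single_smul_apply]
        change (AddMonoidAlgebra.single g r * n).coeff k = r * n.coeff (k - g)
        exact AddMonoidAlgebra.coeff_single_mul_eq_mul_coeff _ fun h _ => eq_sub_iff_add_eq'.symm }

lemma ofLaurent_apply (l : AddMonoidAlgebra R G) (g : G) : ofLaurent l g = l.coeff g := rfl

variable {T : Type*} [Fintype T] [DecidableEq T]

lemma exists_ne_zero_of_smul_apply_ne_zero {D : Matrix T T (AddMonoidAlgebra R G)}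
    {f : T → FormalSeries R G} {s : T} {k : G} (h : (D • f) s k ≠ 0) :
    ∃ t g, (D s t).coeff g ≠ 0 ∧ f t (k - g) ≠ 0 := by
  rw [Matrix.Module.smul_apply, sum_apply] at h
  obtain ⟨t, -, ht⟩ := Finset.exists_ne_zero_of_sum_ne_zero h
  rw [smul_apply] at ht
  obtain ⟨g, hg, hgk⟩ := Finset.exists_ne_zero_of_sum_ne_zero ht
  exact ⟨t, g, Finsupp.mem_support_iff.1 hg, right_ne_zero_of_mul hgk⟩

lemma smul_apply_congr {D : Matrix T T (AddMonoidAlgebra R G)} {f f' : T → FormalSeries R G}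
    {s : T} {k : G} (h : ∀ t g, (D s t).coeff g ≠ 0 → f t (k - g) = f' t (k - g)) :
    (D • f) s k = (D • f') s k := by
  by_contra hne
  obtain ⟨t, g, hg, hne⟩ := exists_ne_zero_of_smul_apply_ne_zero (D := D) (f := f - f')
    (s := s) (k := k) (by rwa [smul_sub, Pi.sub_apply, sub_apply, sub_ne_zero])
  exact hne (sub_eq_zero.2 (h t g hg))

end FormalSeries

lemma exists_support_bound {ι : Type*} [Finite ι] (l : ι → AddMonoidAlgebra R G) (π : G →+ ℤ) :
    ∃ N : ℤ, 0 ≤ N ∧ ∀ i g, (l i).coeff g ≠ 0 → |π g| ≤ N := by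
  have hfin : (⋃ i, (l i).coeff.support : Set G).Finite :=
    Set.finite_iUnion fun i => (l i).coeff.support.finite_toSet
  obtain ⟨N, hN⟩ := (hfin.image fun g => |π g|).bddAbove
  exact ⟨max 0 N, le_max_left 0 N, fun i g hg => (hN ⟨g, Set.mem_iUnion.2
    ⟨i, Finsupp.mem_support_iff.2 hg⟩, rfl⟩).trans (le_max_right 0 N)⟩

namespace FormalSeries

/-- The formal series whose support lies in a half-space `{g | k ≤ π g}`. -/
def boundedBelow (π : G →+ ℤ) : Submodule (AddMonoidAlgebra R G) (FormalSeries R G) where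
  carrier := {f | ∃ k, ∀ g, f g ≠ 0 → k ≤ π g}
  zero_mem' := ⟨0, fun _ h => absurd rfl h⟩
  add_mem' := by
    rintro f f' ⟨k, hk⟩ ⟨k', hk'⟩
    refine ⟨min k k', fun g hg => ?_⟩
    by_cases hf : f g = 0
    · exact (min_le_right k k').trans (hk' g fun h => hg (by rw [add_apply, hf, h, add_zero]))
    · exact (min_le_left k k').trans (hk g hf)
  smul_mem' := by
    rintro l f ⟨k, hk⟩
    obtain ⟨N, -, hN⟩ := exists_support_bound (fun _ : Unit => l) π
    refine ⟨k - N, fun g hg => ?_⟩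
    rw [smul_apply] at hg
    obtain ⟨h, hh, hne⟩ := Finset.exists_ne_zero_of_sum_ne_zero hg
    have hh' := abs_le.1 (hN () h (Finsupp.mem_support_iff.1 hh))
    have := hk _ (right_ne_zero_of_mul hne)
    rw [map_sub] at this
    omega

end FormalSeries

end FormalSeries

open FormalSeries

section ChangeOfVariables

variable {R : Type u} [Ring R]

/-- The isomorphism of group algebras which sends the monomial `g` to `e g`. -/
abbrev changeVars {G G' : Type*} [AddCommGroup G] [AddCommGroup G'] (e : G ≃+ G') :
    AddMonoidAlgebra R G →+* AddMonoidAlgebra R G' :=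
  AddMonoidAlgebra.mapDomainRingHom R e

lemma changeVars_single {G G' : Type*} [AddCommGroup G] [AddCommGroup G'] (e : G ≃+ G') (g : G)
    (r : R) : changeVars e (AddMonoidAlgebra.single g r) = AddMonoidAlgebra.single (e g) r :=
  AddMonoidAlgebra.mapDomain_single ..

/-- The substitution `x ↦ x^ε`, `y ↦ y^δ` on exponents. -/
def signs (ε δ : ℤˣ) : ℤ × ℤ ≃+ ℤ × ℤ :=
  AddEquiv.prodCongr (DistribMulAction.toAddEquiv ℤ ε) (DistribMulAction.toAddEquiv ℤ δ)

lemma signs_apply (ε δ : ℤˣ) (g : ℤ × ℤ) : signs ε δ g = ((ε : ℤ) * g.1, (δ : ℤ) * g.2) := rfl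

lemma vertexHom_single (ε δ : ℤˣ) (g : ℤ × ℤ) (r : R) :
    vertexHom R ε δ (AddMonoidAlgebra.single g r)
      = HahnSeries.single ((ε : ℤ) * g.1, (δ : ℤ) * g.2) r := by
  change AddMonoidAlgebra.liftNC _ _ _ = _
  rw [AddMonoidAlgebra.liftNC_single]
  change HahnSeries.C r * HahnSeries.single _ 1 = _
  rw [HahnSeries.C_apply, HahnSeries.single_mul_single, zero_add, mul_one]
  rfl

lemma edgeHomY_single (δ : ℤˣ) (g : ℤ × ℤ) (r : R) :
    edgeHomY R δ (AddMonoidAlgebra.single g r)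
      = HahnSeries.single ((δ : ℤ) * g.2) (AddMonoidAlgebra.single g.1 r) := by
  change AddMonoidAlgebra.liftNC _ _ _ = _
  rw [AddMonoidAlgebra.liftNC_single]
  change HahnSeries.C (LaurentPolynomial.C r) * HahnSeries.single _ (LaurentPolynomial.T _) = _
  rw [HahnSeries.C_apply, HahnSeries.single_mul_single, zero_add,
    ← LaurentPolynomial.single_eq_C_mul_T]
  rfl

lemma edgeHomX_single (ε : ℤˣ) (g : ℤ × ℤ) (r : R) :
    edgeHomX R ε (AddMonoidAlgebra.single g r)
      = HahnSeries.single ((ε : ℤ) * g.1) (AddMonoidAlgebra.single g.2 r) := by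
  change AddMonoidAlgebra.liftNC _ _ _ = _
  rw [AddMonoidAlgebra.liftNC_single]
  change HahnSeries.C (LaurentPolynomial.C r) * HahnSeries.single _ (LaurentPolynomial.T _) = _
  rw [HahnSeries.C_apply, HahnSeries.single_mul_single, zero_add,
    ← LaurentPolynomial.single_eq_C_mul_T]
  rfl

end ChangeOfVariables

section LaurentCoefficients

variable {R : Type u} [Ring R]

lemma isPWO_iff_bddBelow {s : Set ℤ} : s.IsPWO ↔ BddBelow s := by
  refine ⟨fun h => ?_, fun h => Set.isPWO_iff_isWF.2 h.isWF⟩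
  obtain rfl | hne := s.eq_empty_or_nonempty
  · exact bddBelow_empty
  · exact ⟨h.isWF.min hne, fun b hb => h.isWF.min_le hne hb⟩

/-- The coefficients of an element of `R((x^ε, y^δ))`. -/
def vertexSeries (ε δ : ℤˣ) : Novikov₂ R →+ FormalSeries R (ℤ × ℤ) where
  toFun f g := f.coeff (signs ε δ g)
  map_zero' := rfl
  map_add' _ _ := rfl

lemma vertexSeries_smul (ε δ : ℤˣ) (l : LaurentPoly₂ R) (f : Novikov₂ R) :
    vertexSeries ε δ (vertexHom R ε δ l • f) = l • vertexSeries ε δ f := by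
  refine map_smul_of_single (fun g r f => FormalSeries.ext fun k => ?_) l f
  rw [single_smul_apply, vertexHom_single, ← signs_apply]
  change (HahnSeries.single _ r * f).coeff (signs ε δ k) = r * f.coeff (signs ε δ (k - g))
  rw [HahnSeries.coeff_single_mul, map_sub]

lemma vertexSeries_injective (ε δ : ℤˣ) : Function.Injective (vertexSeries (R := R) ε δ) :=
  fun _ _ h => HahnSeries.ext ((signs ε δ).surjective.injective_comp_right h)

lemma range_vertexSeries (ε δ : ℤˣ) :
    Set.range (vertexSeries (R := R) ε δ) =
      (boundedBelow ((ε : ℤ) • AddMonoidHom.fst ℤ ℤ) ⊓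
        boundedBelow ((δ : ℤ) • AddMonoidHom.snd ℤ ℤ) :
          Submodule (LaurentPoly₂ R) (FormalSeries R (ℤ × ℤ))) := by
  ext f
  constructor
  · rintro ⟨f, rfl⟩
    obtain ⟨k, hk⟩ := (isPWO_support_iff f.coeff).1 f.isPWO_support
    exact ⟨⟨k, fun g hg => (hk _ _ hg).1⟩, ⟨k, fun g hg => (hk _ _ hg).2⟩⟩
  · rintro ⟨⟨k, hk⟩, ⟨k', hk'⟩⟩
    refine ⟨⟨fun g => f ((signs ε δ).symm g), (isPWO_support_iff _).2
      ⟨min k k', fun p q h => ?_⟩⟩, funext fun g => congrArg f ((signs ε δ).symm_apply_apply g)⟩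
    have hpq := (signs ε δ).apply_symm_apply (p, q)
    rw [signs_apply, Prod.mk.injEq] at hpq
    rw [← hpq.1, ← hpq.2]
    exact ⟨(min_le_left k k').trans (hk _ h), (min_le_right k k').trans (hk' _ h)⟩

/-- The coefficients of an element of `R[[x, x⁻¹]]((y))`, a module over `R[x, x⁻¹]((y))`. -/
def edgeSeries : HahnModule ℤ (LaurentPolynomial R) (FormalSeries R ℤ) →+
    FormalSeries R (ℤ × ℤ) where
  toFun f g := ((HahnModule.of _).symm f).coeff g.2 g.1
  map_zero' := rfl
  map_add' _ _ := rfl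

lemma edgeSeries_smul (l : LaurentPoly₂ R)
    (f : HahnModule ℤ (LaurentPolynomial R) (FormalSeries R ℤ)) :
    edgeSeries (edgeHomY R 1 l • f) = l • edgeSeries f := by
  refine map_smul_of_single (fun g r f => FormalSeries.ext fun k => ?_) l f
  rw [single_smul_apply, edgeHomY_single, Units.val_one, one_mul]
  change ((HahnModule.of (LaurentPolynomial R)).symm
    (HahnSeries.single g.2 (AddMonoidAlgebra.single g.1 r) • f)).coeff k.2 k.1 = _
  rw [← add_sub_cancel g.2 k.2, ← vadd_eq_add, HahnModule.coeff_single_smul_vadd,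
    single_smul_apply]
  rfl

lemma edgeSeries_injective : Function.Injective (edgeSeries (R := R)) :=
  fun _ _ h => HahnModule.ext _ _ (funext fun q => funext fun p => congrFun h (p, q))

lemma range_edgeSeries :
    Set.range (edgeSeries (R := R)) =
      (boundedBelow (AddMonoidHom.snd ℤ ℤ) :
        Submodule (LaurentPoly₂ R) (FormalSeries R (ℤ × ℤ))) := by
  ext f
  constructor
  · rintro ⟨f, rfl⟩
    obtain ⟨k, hk⟩ := isPWO_iff_bddBelow.1 ((HahnModule.of _).symm f).isPWO_support
    exact ⟨k, fun g hg => hk fun h => hg (congrFun h g.1)⟩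
  · rintro ⟨k, hk⟩
    refine ⟨HahnModule.of _ ⟨fun q p => f (p, q), isPWO_iff_bddBelow.2 ⟨k, fun q hq => ?_⟩⟩, rfl⟩
    obtain ⟨p, hp⟩ := Function.ne_iff.1 hq
    exact hk _ hp

variable {T : Type*} [Fintype T] [DecidableEq T] {D : Matrix T T (LaurentPoly₂ R)}

lemma isExactOver_vertexHom_iff (ε δ : ℤˣ) :
    IsExactOver (vertexHom R ε δ) D ↔
      IsExactOn D (boundedBelow ((ε : ℤ) • AddMonoidHom.fst ℤ ℤ) ⊓
        boundedBelow ((δ : ℤ) • AddMonoidHom.snd ℤ ℤ) :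
          Submodule (LaurentPoly₂ R) (FormalSeries R (ℤ × ℤ))) :=
  isExactOn_iff_of_range_eq (vertexSeries_smul ε δ) (vertexSeries_injective ε δ)
    (range_vertexSeries ε δ) D

lemma IsExactOver.isExactOn_boundedBelow_snd {deg : T → ℤ} (hD : IsGradedDifferential deg D)
    (h : IsExactOver (edgeHomY R 1) D) :
    IsExactOn D (boundedBelow (AddMonoidHom.snd ℤ ℤ) :
      Submodule (LaurentPoly₂ R) (FormalSeries R (ℤ × ℤ))) := by
  obtain ⟨s, hs⟩ := (hD.map _).exists_contraction h
  exact (isExactOn_iff_of_range_eq edgeSeries_smul edgeSeries_injective range_edgeSeries D).1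
    (IsExactOn.of_contraction hs ⊤)

end LaurentCoefficients

section ThinRing

variable {R : Type u} [Ring R] {G : Type*} [AddCommGroup G]

variable (R) in
/-- The ring `R((y))[x, x⁻¹]`, which is contained in `R((x, y))`, in `R((x⁻¹, y))` and in
`R[x, x⁻¹]((y))`. -/
abbrev ThinRing : Type u := LaurentPolynomial (LaurentSeries R)

variable (R) in
/-- The inclusion of a group algebra into `R((y))[x, x⁻¹]`, in the coordinates given by `e`. -/
def thinHom (e : G ≃+ ℤ × ℤ) : AddMonoidAlgebra R G →+* ThinRing R :=
  AddMonoidAlgebra.liftNCRingHom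
    ((AddMonoidAlgebra.singleZeroRingHom : LaurentSeries R →+* ThinRing R).comp HahnSeries.C)
    { toFun := fun g => AddMonoidAlgebra.single (e g.toAdd).1 (HahnSeries.single (e g.toAdd).2 1)
      map_one' := by
        rw [toAdd_one, map_zero]
        rfl
      map_mul' := fun g h => by
        rw [AddMonoidAlgebra.single_mul_single, HahnSeries.single_mul_single, one_mul, toAdd_mul,
          map_add, Prod.fst_add, Prod.snd_add] }
    (fun r g => by
      change AddMonoidAlgebra.single _ _ * AddMonoidAlgebra.single _ _ =
        AddMonoidAlgebra.single _ _ * AddMonoidAlgebra.single _ _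
      simp only [HahnSeries.C_apply, AddMonoidAlgebra.single_mul_single,
        HahnSeries.single_mul_single, add_zero, zero_add, mul_one, one_mul])

lemma thinHom_single (e : G ≃+ ℤ × ℤ) (g : G) (r : R) :
    thinHom R e (AddMonoidAlgebra.single g r)
      = AddMonoidAlgebra.single (e g).1 (HahnSeries.single (e g).2 r) := by
  change AddMonoidAlgebra.liftNC _ _ _ = _
  rw [AddMonoidAlgebra.liftNC_single]
  change AddMonoidAlgebra.single 0 (HahnSeries.single 0 r) *
    AddMonoidAlgebra.single _ (HahnSeries.single _ 1) = _
  rw [AddMonoidAlgebra.single_mul_single, HahnSeries.single_mul_single, zero_add, zero_add,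
    mul_one]
  rfl

/-- The coefficients of an element of `R((y))[x, x⁻¹]`. -/
def thinSeries (e : G ≃+ ℤ × ℤ) : ThinRing R →+ FormalSeries R G where
  toFun b g := (b.coeff (e g).1).coeff (e g).2
  map_zero' := rfl
  map_add' _ _ := rfl

lemma thinSeries_apply (e : G ≃+ ℤ × ℤ) (b : ThinRing R) (g : G) :
    thinSeries e b g = (b.coeff (e g).1).coeff (e g).2 := rfl

lemma thinSeries_smul (e : G ≃+ ℤ × ℤ) (l : AddMonoidAlgebra R G) (b : ThinRing R) :
    thinSeries e (thinHom R e l • b) = l • thinSeries e b := by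
  refine map_smul_of_single (fun g r b => FormalSeries.ext fun k => ?_) l b
  rw [single_smul_apply, thinHom_single, smul_eq_mul, thinSeries_apply, thinSeries_apply,
    AddMonoidAlgebra.coeff_single_mul_eq_mul_coeff ((e k).1 - (e g).1)
      fun _ _ => eq_sub_iff_add_eq'.symm, HahnSeries.coeff_single_mul, map_sub e, Prod.fst_sub,
    Prod.snd_sub]

lemma thinSeries_mul_single (e : G ≃+ ℤ × ℤ) (b : ThinRing R) (g : G) (r : R) (k : G) :
    thinSeries e (b * thinHom R e (AddMonoidAlgebra.single g r)) k
      = thinSeries e b (k - g) * r := by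
  rw [thinHom_single, thinSeries_apply, thinSeries_apply,
    AddMonoidAlgebra.coeff_mul_single_eq_coeff_mul ((e k).1 - (e g).1)
      fun _ _ => eq_sub_iff_add_eq.symm, HahnSeries.coeff_mul_single, map_sub e, Prod.fst_sub,
    Prod.snd_sub]

lemma thinSeries_one (e : G ≃+ ℤ × ℤ) : thinSeries (R := R) e 1 = ofLaurent 1 := by
  classical
  ext g
  have hg : 0 = g ↔ 0 = (e g).1 ∧ 0 = (e g).2 := by
    rw [eq_comm, ← map_eq_zero_iff e e.injective, Prod.ext_iff, eq_comm, eq_comm (a := (e g).2)]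
    rfl
  rw [thinSeries_apply, ofLaurent_apply, AddMonoidAlgebra.one_def, AddMonoidAlgebra.one_def,
    AddMonoidAlgebra.coeff_single, AddMonoidAlgebra.coeff_single, Finsupp.single_apply,
    Finsupp.single_apply]
  by_cases h₁ : 0 = (e g).1
  · simp [hg, ← h₁, HahnSeries.coeff_one, eq_comm]
  · simp [hg, h₁]

lemma thinSeries_thinHom (e : G ≃+ ℤ × ℤ) (l : AddMonoidAlgebra R G) :
    thinSeries e (thinHom R e l) = ofLaurent l := by
  rw [← mul_one (thinHom R e l), ← smul_eq_mul, thinSeries_smul, thinSeries_one, ← map_smul,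
    smul_eq_mul, mul_one]

lemma thinSeries_injective (e : G ≃+ ℤ × ℤ) : Function.Injective (thinSeries (R := R) e) := by
  intro b b' h
  ext p q
  simpa [thinSeries_apply] using congrFun h (e.symm (p, q))

variable (R) in
/-- The formal series which, in the coordinates given by `e`, are the elements of
`R((y))[x, x⁻¹]`. -/
def thinSubmodule (e : G ≃+ ℤ × ℤ) : Submodule (AddMonoidAlgebra R G) (FormalSeries R G) :=
  boundedBelow ((AddMonoidHom.fst ℤ ℤ).comp (e : G →+ ℤ × ℤ)) ⊓
    boundedBelow (-(AddMonoidHom.fst ℤ ℤ).comp (e : G →+ ℤ × ℤ)) ⊓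
    boundedBelow ((AddMonoidHom.snd ℤ ℤ).comp (e : G →+ ℤ × ℤ))

lemma mem_thinSubmodule {e : G ≃+ ℤ × ℤ} {f : FormalSeries R G} :
    f ∈ thinSubmodule R e ↔ ∃ m, ∀ g, f g ≠ 0 → |(e g).1| ≤ m ∧ -m ≤ (e g).2 := by
  constructor
  · rintro ⟨⟨⟨a, ha⟩, ⟨b, hb⟩⟩, ⟨c, hc⟩⟩
    refine ⟨max (-a) (max (-b) (-c)), fun g hg => ?_⟩
    have ha := ha g hg
    have hb := hb g hg
    have hc := hc g hg
    change a ≤ (e g).1 at ha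
    change b ≤ -(e g).1 at hb
    change c ≤ (e g).2 at hc
    rw [abs_le]
    omega
  · rintro ⟨m, hm⟩
    exact ⟨⟨⟨-m, fun g hg => (abs_le.1 (hm g hg).1).1⟩,
      ⟨-m, fun g hg => neg_le_neg (abs_le.1 (hm g hg).1).2⟩⟩, ⟨-m, fun g hg => (hm g hg).2⟩⟩

lemma thinSeries_mem (e : G ≃+ ℤ × ℤ) (b : ThinRing R) : thinSeries e b ∈ thinSubmodule R e := by
  choose k hk using fun p => isPWO_iff_bddBelow.1 (b.coeff p).isPWO_support
  obtain ⟨m, hm⟩ := (b.coeff.support.image fun p => max |p| (-k p)).bddAbove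
  refine mem_thinSubmodule.2 ⟨m, fun g hg => ?_⟩
  have hp : (e g).1 ∈ b.coeff.support :=
    Finsupp.mem_support_iff.2 fun h => hg (by rw [thinSeries_apply, h, HahnSeries.coeff_zero])
  have hmax := max_le_iff.1 (hm (Finset.mem_coe.2 (Finset.mem_image_of_mem _ hp)))
  exact ⟨hmax.1, (neg_le.1 hmax.2).trans (hk _ hg)⟩

lemma range_thinSeries (e : G ≃+ ℤ × ℤ) :
    Set.range (thinSeries (R := R) e) = thinSubmodule R e := by
  refine Set.Subset.antisymm (Set.range_subset_iff.2 (thinSeries_mem e)) fun f hf => ?_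
  obtain ⟨m, hm⟩ := mem_thinSubmodule.1 hf
  have hm' (p q : ℤ) (h : f (e.symm (p, q)) ≠ 0) : |p| ≤ m ∧ -m ≤ q := by simpa using hm _ h
  let row (p : ℤ) : LaurentSeries R :=
    ⟨fun q => f (e.symm (p, q)), isPWO_iff_bddBelow.2 ⟨-m, fun q hq => (hm' p q hq).2⟩⟩
  have hrow : (Function.support row).Finite := by
    refine (Set.finite_Icc (-m) m).subset fun p hp => ?_
    obtain ⟨q, hq⟩ := Function.ne_iff.1 fun h => hp (HahnSeries.ext h)
    exact abs_le.1 (hm' p q hq).1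
  refine ⟨.ofCoeff (Finsupp.ofSupportFinite row hrow), FormalSeries.ext fun g => ?_⟩
  change f (e.symm (e g)) = f g
  rw [e.symm_apply_apply]

lemma thinHom_eq_comp_changeVars {G' : Type*} [AddCommGroup G'] (e : G ≃+ G')
    (e' : G' ≃+ ℤ × ℤ) : thinHom R (e.trans e') = (thinHom R e').comp (changeVars e) :=
  AddMonoidAlgebra.ringHom_ext (fun r => by simp [thinHom_single]) (fun g => by
    simp [thinHom_single])

variable {T : Type*} [Fintype T] [DecidableEq T]

lemma isExactOver_thinHom_iff (e : G ≃+ ℤ × ℤ) (D : Matrix T T (AddMonoidAlgebra R G)) :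
    IsExactOver (thinHom R e) D ↔ IsExactOn D (thinSubmodule R e) :=
  isExactOn_iff_of_range_eq (thinSeries_smul e) (thinSeries_injective e) (range_thinSeries e) D

end ThinRing

section MayerVietoris

variable {R : Type u} [Ring R]

lemma boundedBelow_sup_boundedBelow_neg {G : Type*} [AddCommGroup G] (π : G →+ ℤ)
    (ρ : G →+ ℤ) :
    (boundedBelow π ⊓ boundedBelow ρ) ⊔ (boundedBelow (-π) ⊓ boundedBelow ρ) =
      (boundedBelow ρ : Submodule (AddMonoidAlgebra R G) (FormalSeries R G)) := by
  refine le_antisymm (sup_le inf_le_right inf_le_right) ?_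
  rintro f ⟨k, hk⟩
  let f₁ : FormalSeries R G := fun g => if 0 ≤ π g then f g else 0
  let f₂ : FormalSeries R G := fun g => if 0 ≤ π g then 0 else f g
  have hf : f₁ + f₂ = f := FormalSeries.ext fun g => by
    change f₁ g + f₂ g = f g
    by_cases hg : 0 ≤ π g <;> simp [f₁, f₂, hg]
  rw [← hf]
  refine Submodule.add_mem_sup
    ⟨⟨0, fun g hg => ?_⟩, ⟨k, fun g hg => hk g fun h => hg (by simp [f₁, h])⟩⟩
    ⟨⟨0, fun g hg => ?_⟩, ⟨k, fun g hg => hk g fun h => hg (by simp [f₂, h])⟩⟩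
  · exact of_not_not fun h => hg (if_neg h)
  · exact neg_nonneg.2 (le_of_not_ge fun h => hg (if_pos h))

variable {T : Type*} [Fintype T] [DecidableEq T] {deg : T → ℤ} {D : Matrix T T (LaurentPoly₂ R)}

lemma isExactOver_thinHom_refl (hD : IsGradedDifferential deg D)
    (hedge : IsExactOver (edgeHomY R 1) D) (hvertex : ∀ ε, IsExactOver (vertexHom R ε 1) D) :
    IsExactOver (thinHom R (AddEquiv.refl _)) D := by
  have hpos := (isExactOver_vertexHom_iff 1 1).1 (hvertex 1)
  have hneg := (isExactOver_vertexHom_iff (-1) 1).1 (hvertex (-1))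
  simp only [Units.val_one, Units.val_neg, neg_smul, one_smul] at hpos hneg
  refine (isExactOver_thinHom_iff _ _).2 ?_
  convert hpos.inf hD.mul_self hneg ?_ using 1
  · exact inf_inf_distrib_right _ _ _
  · rw [boundedBelow_sup_boundedBelow_neg]
    exact hedge.isExactOn_boundedBelow_snd hD

end MayerVietoris

section NovikovFromThin

variable {R : Type u} [Ring R]

/-- The exchange of `x` and `y` followed by the substitution `y ↦ y^δ`, on exponents. -/
def swapSigns (δ : ℤˣ) : ℤ × ℤ ≃+ ℤ × ℤ := AddEquiv.prodComm.trans (signs 1 δ)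

lemma addMonoidAlgebra_ringHom_ext {S G : Type*} [Ring S] [AddCommGroup G]
    {φ ψ : AddMonoidAlgebra R G →+* S}
    (h : ∀ g r, φ (AddMonoidAlgebra.single g r) = ψ (AddMonoidAlgebra.single g r)) : φ = ψ :=
  RingHom.coe_addMonoidHom_injective (AddMonoidAlgebra.addMonoidHom_ext h)

lemma vertexHom_eq_comp_signs (ε δ : ℤˣ) :
    vertexHom R ε δ = (vertexHom R ε 1).comp (changeVars (signs 1 δ)) :=
  addMonoidAlgebra_ringHom_ext fun g r => by
    simp only [RingHom.comp_apply, changeVars_single, vertexHom_single, signs_apply, Units.val_one,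
      one_mul]

lemma edgeHomY_eq_comp_signs (δ : ℤˣ) :
    edgeHomY R δ = (edgeHomY R 1).comp (changeVars (signs 1 δ)) :=
  addMonoidAlgebra_ringHom_ext fun g r => by
    simp only [RingHom.comp_apply, changeVars_single, edgeHomY_single, signs_apply, Units.val_one,
      one_mul]

lemma swapSigns_apply (δ : ℤˣ) (g : ℤ × ℤ) : swapSigns δ g = (g.2, (δ : ℤ) * g.1) :=
  Prod.ext (one_mul g.2) rfl

lemma edgeHomX_eq_comp_swapSigns (ε : ℤˣ) :
    edgeHomX R ε = (edgeHomY R 1).comp (changeVars (swapSigns ε)) :=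
  addMonoidAlgebra_ringHom_ext fun g r => by
    simp only [RingHom.comp_apply, changeVars_single, edgeHomX_single, edgeHomY_single,
      swapSigns_apply, Units.val_one, one_mul]

lemma embDomainRingHom_single {Γ Γ' : Type*} [AddCommMonoid Γ] [PartialOrder Γ]
    [IsOrderedCancelAddMonoid Γ] [AddCommMonoid Γ'] [PartialOrder Γ'] [IsOrderedCancelAddMonoid Γ']
    (f : Γ →+ Γ') (hfi : Function.Injective f) (hf : ∀ g g' : Γ, f g ≤ f g' ↔ g ≤ g') (g : Γ)
    (r : R) :
    HahnSeries.embDomainRingHom f hfi hf (HahnSeries.single g r) = HahnSeries.single (f g) r :=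
  HahnSeries.embDomain_single

/-- The isomorphism `R((s, t)) → R((t, s))`. -/
def swapVertex : Novikov₂ R →+* Novikov₂ R :=
  HahnSeries.embDomainRingHom ((AddMonoidHom.snd ℤ ℤ).prod (AddMonoidHom.fst ℤ ℤ))
    Prod.swap_injective fun _ _ => and_comm

lemma swapVertex_single (g : ℤ × ℤ) (r : R) :
    swapVertex (HahnSeries.single g r) = HahnSeries.single (g.2, g.1) r :=
  embDomainRingHom_single ..

lemma vertexHom_comp_swapSigns (ε δ : ℤˣ) :
    (vertexHom R δ 1).comp (changeVars (swapSigns ε)) = swapVertex.comp (vertexHom R ε δ) :=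
  addMonoidAlgebra_ringHom_ext fun g r => by
    rw [RingHom.comp_apply, RingHom.comp_apply, changeVars_single, vertexHom_single,
      vertexHom_single, swapSigns_apply, swapVertex_single, Units.val_one, one_mul]

lemma exists_thinRing_ringHom {S : Type*} [Ring S] (f : LaurentSeries R →+* S)
    (x : Multiplicative ℤ →* S) (h : ∀ b p, Commute (f b) (x p)) :
    ∃ ψ : ThinRing R →+* S, ∀ p b, ψ (AddMonoidAlgebra.single p b) = f b * x (.ofAdd p) :=
  ⟨AddMonoidAlgebra.liftNCRingHom f x h, fun _ _ => AddMonoidAlgebra.liftNC_single ..⟩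

lemma exists_thinRing_to_edgeNovikov : ∃ ψ : ThinRing R →+* EdgeNovikov R, ∀ p q r,
    ψ (AddMonoidAlgebra.single p (HahnSeries.single q r))
      = HahnSeries.single q (AddMonoidAlgebra.single p r) := by
  let coeffs : LaurentSeries R →+* EdgeNovikov R :=
    { toFun := fun b => b.map (LaurentPolynomial.C : R →+* LaurentPolynomial R)
      map_zero' := HahnSeries.map_zero (LaurentPolynomial.C : R →+* _).toMonoidWithZeroHom.toZeroHom
      map_one' := HahnSeries.map_one (LaurentPolynomial.C : R →+* _).toMonoidWithZeroHom
      map_add' := fun _ _ => HahnSeries.map_add (LaurentPolynomial.C : R →+* _).toAddMonoidHom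
      map_mul' := fun _ _ =>
        HahnSeries.map_mul (LaurentPolynomial.C : R →+* _).toNonUnitalRingHom }
  obtain ⟨ψ, hψ⟩ := exists_thinRing_ringHom coeffs
    ((HahnSeries.C : LaurentPolynomial R →+* EdgeNovikov R).toMonoidHom.comp
      (AddMonoidAlgebra.of R ℤ)) fun b p => by
    ext q : 2
    simp [coeffs, HahnSeries.C_apply]
  refine ⟨ψ, fun p q r => ?_⟩
  rw [hψ]
  change (HahnSeries.single q r).map (LaurentPolynomial.C : R →+* _).toAddMonoidHom.toZeroHom *
    HahnSeries.single 0 (AddMonoidAlgebra.single p 1) = _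
  rw [HahnSeries.map_single, HahnSeries.single_mul_single, add_zero]
  change HahnSeries.single q (AddMonoidAlgebra.single 0 r * AddMonoidAlgebra.single p 1) = _
  rw [AddMonoidAlgebra.single_mul_single, zero_add, mul_one]

lemma exists_thinRing_to_novikov₂ : ∃ ψ : ThinRing R →+* Novikov₂ R, ∀ p q r,
    ψ (AddMonoidAlgebra.single p (HahnSeries.single q r)) = HahnSeries.single (p + q, q) r := by
  let diagonal : LaurentSeries R →+* Novikov₂ R :=
    HahnSeries.embDomainRingHom ((AddMonoidHom.id ℤ).prod (AddMonoidHom.id ℤ))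
      (fun _ _ h => congrArg Prod.fst h) fun _ _ => and_self_iff
  let power : Multiplicative ℤ →* Novikov₂ R :=
    { toFun := fun p => HahnSeries.single (p.toAdd, 0) 1
      map_one' := rfl
      map_mul' := fun p q => by simp [HahnSeries.single_mul_single] }
  obtain ⟨ψ, hψ⟩ := exists_thinRing_ringHom diagonal power fun b p => HahnSeries.ext <| by
    funext g
    change (diagonal b * HahnSeries.single _ 1).coeff g =
      (HahnSeries.single _ 1 * diagonal b).coeff g
    rw [HahnSeries.coeff_mul_single, HahnSeries.coeff_single_mul, mul_one, one_mul]
  refine ⟨ψ, fun p q r => ?_⟩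
  rw [hψ]
  have hq : diagonal (HahnSeries.single q r) = HahnSeries.single (q, q) r :=
    embDomainRingHom_single ..
  change diagonal (HahnSeries.single q r) * HahnSeries.single (p, 0) 1 = _
  rw [hq, HahnSeries.single_mul_single, mul_one, Prod.mk_add_mk, add_zero, add_comm]

/-- The shear `x^p y^q ↦ x^(p - q) y^q`: in these coordinates `R((x, y))` contains the thin ring. -/
def shear : ℤ × ℤ ≃+ ℤ × ℤ where
  toFun g := (g.1 - g.2, g.2)
  invFun g := (g.1 + g.2, g.2)
  left_inv g := by simp
  right_inv g := by simp
  map_add' g h := by simp [add_sub_add_comm]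

variable {T : Type*} [Fintype T] [DecidableEq T] {deg : T → ℤ} {D : Matrix T T (LaurentPoly₂ R)}

lemma IsExactOver.edgeHomY_comp (hD : IsGradedDifferential deg D) {e : ℤ × ℤ ≃+ ℤ × ℤ}
    (h : IsExactOver (thinHom R e) D) : IsExactOver ((edgeHomY R 1).comp (changeVars e)) D := by
  obtain ⟨ψ, hψ⟩ := exists_thinRing_to_edgeNovikov (R := R)
  convert h.comp hD ψ using 1
  exact addMonoidAlgebra_ringHom_ext fun g r => by
    simp only [RingHom.comp_apply, changeVars_single, edgeHomY_single, thinHom_single, hψ,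
      Units.val_one, one_mul]

lemma isExactOver_vertexHom_of_thinHom (hD : IsGradedDifferential deg D) {ε δ : ℤˣ}
    (h : IsExactOver (thinHom R ((signs ε δ).trans shear)) D) :
    IsExactOver (vertexHom R ε δ) D := by
  obtain ⟨ψ, hψ⟩ := exists_thinRing_to_novikov₂ (R := R)
  convert h.comp hD ψ using 1
  exact addMonoidAlgebra_ringHom_ext fun g r => by
    rw [RingHom.comp_apply, thinHom_single, hψ, vertexHom_single]
    simp [signs_apply, shear]

lemma isExactOver_thinHom (hD : IsGradedDifferential deg D) {e : ℤ × ℤ ≃+ ℤ × ℤ}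
    (hedge : IsExactOver ((edgeHomY R 1).comp (changeVars e)) D)
    (hvertex : ∀ ε, IsExactOver ((vertexHom R ε 1).comp (changeVars e)) D) :
    IsExactOver (thinHom R e) D := by
  have trans_refl : e.trans (AddEquiv.refl _) = e := AddEquiv.ext fun _ => rfl
  rw [← trans_refl, thinHom_eq_comp_changeVars]
  exact isExactOver_comp_iff.2 (isExactOver_thinHom_refl (hD.map (changeVars e))
    (isExactOver_comp_iff.1 hedge) fun ε => isExactOver_comp_iff.1 (hvertex ε))

lemma isExactOver_thinHom_signs (hD : IsGradedDifferential deg D) {δ : ℤˣ}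
    (hedge : IsExactOver (edgeHomY R δ) D) (hvertex : ∀ ε, IsExactOver (vertexHom R ε δ) D) :
    IsExactOver (thinHom R (signs 1 δ)) D :=
  isExactOver_thinHom hD (edgeHomY_eq_comp_signs (R := R) δ ▸ hedge)
    fun ε => vertexHom_eq_comp_signs (R := R) ε δ ▸ hvertex ε

lemma isExactOver_thinHom_swapSigns (hD : IsGradedDifferential deg D) {ε : ℤˣ}
    (hedge : IsExactOver (edgeHomX R ε) D) (hvertex : ∀ δ, IsExactOver (vertexHom R ε δ) D) :
    IsExactOver (thinHom R (swapSigns ε)) D :=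
  isExactOver_thinHom hD (edgeHomX_eq_comp_swapSigns (R := R) ε ▸ hedge)
    fun δ => vertexHom_comp_swapSigns (R := R) ε δ ▸ (hvertex δ).comp hD swapVertex

end NovikovFromThin

section Supports

variable (R : Type*) {G T : Type*} [Ring R]

/-- The vectors of Laurent polynomials all of whose nonzero coefficients are at positions in `A`,
the position `(t, g)` being that of the monomial `g` in the component `t`. -/
def supportedIn (A : Set (T × G)) : Submodule Rᵐᵒᵖ (T → AddMonoidAlgebra R G) where
  carrier := {v | ∀ t g, (v t).coeff g ≠ 0 → (t, g) ∈ A}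
  zero_mem' := fun _ _ h => absurd rfl h
  add_mem' := fun {v w} hv hw t g => not_imp_comm.1 fun hA => by
    rw [Pi.add_apply, AddMonoidAlgebra.coeff_add, Finsupp.add_apply,
      not_imp_comm.1 (hv t g) hA, not_imp_comm.1 (hw t g) hA, add_zero]
  smul_mem' := fun r v hv t g h => hv t g fun h0 => h (by
    rw [Pi.smul_apply, AddMonoidAlgebra.coeff_smul_apply, h0, smul_zero])

variable {R}

lemma supportedIn_mono {A B : Set (T × G)} (h : A ⊆ B) : supportedIn R A ≤ supportedIn R B :=
  fun _ hv t g hne => h (hv t g hne)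

lemma supportedIn_inter (A B : Set (T × G)) :
    supportedIn R (A ∩ B) = supportedIn R A ⊓ supportedIn R B :=
  le_antisymm (le_inf (supportedIn_mono Set.inter_subset_left)
    (supportedIn_mono Set.inter_subset_right)) fun _ hv t g h => ⟨hv.1 t g h, hv.2 t g h⟩

lemma exists_coeff_eq {A : Set (T × G)} (hA : A.Finite) (f : A → R) :
    ∃ v ∈ supportedIn R A, ∀ p : A, (v p.1.1).coeff p.1.2 = f p := by
  classical
  let extended (t : T) (g : G) : R := if h : (t, g) ∈ A then f ⟨_, h⟩ else 0
  have mem_of_ne {t g} (h : extended t g ≠ 0) : (t, g) ∈ A :=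
    by_contra fun hA => h (dif_neg hA)
  refine ⟨fun t => .ofCoeff (Finsupp.ofSupportFinite (extended t)
    ((hA.image Prod.snd).subset fun g hg => ⟨(t, g), mem_of_ne hg, rfl⟩)),
    fun t g h => mem_of_ne h, fun p => dif_pos p.2⟩

/-- Vectors with support in a finite set `A` are families of coefficients indexed by `A`. -/
def supportedInEquiv {A : Set (T × G)} (hA : A.Finite) : supportedIn R A ≃ₗ[Rᵐᵒᵖ] (A → Rᵐᵒᵖ) :=
  LinearEquiv.ofBijective
    { toFun := fun v p => MulOpposite.op ((v.1 p.1.1).coeff p.1.2)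
      map_add' := fun _ _ => rfl
      map_smul' := fun r v => funext fun p => by
        rw [Submodule.coe_smul, Pi.smul_apply, AddMonoidAlgebra.coeff_smul_apply]
        rfl }
    ⟨fun v w h => Subtype.ext <| funext fun t => AddMonoidAlgebra.ext <| Finsupp.ext fun g => by
        by_cases hg : (t, g) ∈ A
        · exact MulOpposite.op_injective (congrFun h ⟨_, hg⟩)
        · rw [not_imp_comm.1 (v.2 t g) hg, not_imp_comm.1 (w.2 t g) hg],
      fun f => by
        obtain ⟨v, hv, hvf⟩ := exists_coeff_eq hA fun p => (f p).unop
        exact ⟨⟨v, hv⟩, funext fun p => congrArg MulOpposite.op (hvf p)⟩⟩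

lemma finite_supportedIn {A : Set (T × G)} (hA : A.Finite) :
    Module.Finite Rᵐᵒᵖ (supportedIn R A) := by
  have := hA.to_subtype
  exact Module.Finite.equiv (supportedInEquiv hA).symm

lemma projective_supportedIn {A : Set (T × G)} (hA : A.Finite) :
    Module.Projective Rᵐᵒᵖ (supportedIn R A) := by
  have := hA.to_subtype
  exact Module.Projective.of_equiv (supportedInEquiv hA).symm

lemma exists_le_supportedIn [Finite T] {N : Submodule Rᵐᵒᵖ (T → AddMonoidAlgebra R G)}
    (hN : N.FG) : ∃ A : Set (T × G), A.Finite ∧ N ≤ supportedIn R A := by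
  obtain ⟨S, rfl⟩ := hN
  refine ⟨⋃ v ∈ S, ⋃ t, Prod.mk t '' (v t).coeff.support, S.finite_toSet.biUnion fun v _ =>
    Set.finite_iUnion fun t => ((v t).coeff.support.finite_toSet.image _),
    Submodule.span_le.2 fun v hv t g h => ?_⟩
  exact Set.mem_biUnion hv (Set.mem_iUnion.2 ⟨t, g, Finsupp.mem_support_iff.2 h, rfl⟩)

lemma exists_map_supportedIn_le [Finite T] (f : Module.End Rᵐᵒᵖ (T → AddMonoidAlgebra R G))
    {A : Set (T × G)} (hA : A.Finite) :
    ∃ B : Set (T × G), B.Finite ∧ ∀ v ∈ supportedIn R A, f v ∈ supportedIn R B := by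
  obtain ⟨B, hB, hle⟩ := exists_le_supportedIn
    ((Module.Finite.iff_fg.1 (finite_supportedIn (R := R) hA)).map f)
  exact ⟨B, hB, fun v hv => hle (Submodule.mem_map_of_mem hv)⟩

end Supports

section HomotopyDefect

variable {A V : Type*} [Ring A] [AddCommGroup V] [Module A V]

/-- The endomorphism `1 - d h - h d` of a module with differential `d`: it is homotopic to the
identity through `h`, and vanishes exactly if `h` is a contraction. -/
def homotopyDefect (d h : Module.End A V) : Module.End A V := 1 - d * h - h * d

lemma homotopyDefect_apply (d h : Module.End A V) (v : V) :
    homotopyDefect d h v = v - d (h v) - h (d v) := rfl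

lemma homotopyDefect_add_mul {d : Module.End A V} (hd : d * d = 0) (h h' : Module.End A V) :
    homotopyDefect d (h + homotopyDefect d h * h') = homotopyDefect d h * homotopyDefect d h' := by
  have hd' (x : Module.End A V) : d * (d * x) = 0 := by rw [← mul_assoc, hd, zero_mul]
  simp only [homotopyDefect, mul_add, add_mul, sub_mul, mul_sub, mul_one, one_mul, mul_assoc,
    hd', mul_zero]
  abel

end HomotopyDefect

section MatrixOperator

variable {A N T : Type*} (B : Type*) [Ring A] [Ring B] [AddCommGroup N] [Module A N] [Module B N]
  [SMulCommClass B A N] [Fintype T] [DecidableEq T]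

/-- The action of a matrix on vectors, as an endomorphism over a ring `B` whose action commutes
with that of the entries of the matrix. -/
def mulOp (D : Matrix T T A) : Module.End B (T → N) where
  toFun v := D • v
  map_add' := smul_add D
  map_smul' b v := funext fun s => by
    simp only [Matrix.Module.smul_apply, Pi.smul_apply, smul_comm, Finset.smul_sum,
      RingHom.id_apply]

variable {B}

lemma mulOp_apply (D : Matrix T T A) (v : T → N) : mulOp B D v = D • v := rfl

lemma mulOp_mul_self {D : Matrix T T A} (hD : D * D = 0) :
    (mulOp B D * mulOp B D : Module.End B (T → N)) = 0 :=
  LinearMap.ext fun v => by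
    rw [Module.End.mul_apply, mulOp_apply, mulOp_apply, smul_smul, hD, zero_smul,
      LinearMap.zero_apply]

end MatrixOperator

section Propagation

variable {R G T : Type*} [Ring R]

/-- An operator on vectors of Laurent polynomials has finite propagation in the direction `π` if
it moves supports only by a bounded amount, measured by `π`. -/
def HasFinitePropagation [AddCommGroup G] (π : G →+ ℤ)
    (f : Module.End Rᵐᵒᵖ (T → AddMonoidAlgebra R G)) : Prop :=
  ∃ M, ∀ v t g, (f v t).coeff g ≠ 0 → ∃ s k, (v s).coeff k ≠ 0 ∧ |π (g - k)| ≤ M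

variable [AddCommGroup G] {π : G →+ ℤ} {f f' : Module.End Rᵐᵒᵖ (T → AddMonoidAlgebra R G)}

lemma hasFinitePropagation_one :
    HasFinitePropagation π (1 : Module.End Rᵐᵒᵖ (T → AddMonoidAlgebra R G)) :=
  ⟨0, fun _ t g h => ⟨t, g, h, by rw [sub_self, map_zero, abs_zero]⟩⟩

lemma HasFinitePropagation.sub (hf : HasFinitePropagation π f) (hf' : HasFinitePropagation π f') :
    HasFinitePropagation π (f - f') := by
  obtain ⟨M, hM⟩ := hf
  obtain ⟨M', hM'⟩ := hf'
  refine ⟨max M M', fun v t g h => ?_⟩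
  by_cases h0 : (f v t).coeff g = 0
  · have h' : (f' v t).coeff g ≠ 0 := fun h1 => h (by
      rw [LinearMap.sub_apply, Pi.sub_apply, AddMonoidAlgebra.coeff_sub, Finsupp.sub_apply, h0, h1,
        sub_zero])
    obtain ⟨s, k, hk, hle⟩ := hM' v t g h'
    exact ⟨s, k, hk, hle.trans (le_max_right M M')⟩
  · obtain ⟨s, k, hk, hle⟩ := hM v t g h0
    exact ⟨s, k, hk, hle.trans (le_max_left M M')⟩

lemma HasFinitePropagation.mul (hf : HasFinitePropagation π f) (hf' : HasFinitePropagation π f') :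
    HasFinitePropagation π (f * f') := by
  obtain ⟨M, hM⟩ := hf
  obtain ⟨M', hM'⟩ := hf'
  refine ⟨M + M', fun v t g h => ?_⟩
  obtain ⟨s, k, hk, hle⟩ := hM _ t g h
  obtain ⟨s', k', hk', hle'⟩ := hM' v s k hk
  refine ⟨s', k', hk', ?_⟩
  rw [← sub_add_sub_cancel g k k', map_add]
  exact (abs_add_le _ _).trans (add_le_add hle hle')

variable [Fintype T] [DecidableEq T]

lemma ofLaurent_comp_smul (D : Matrix T T (AddMonoidAlgebra R G)) (v : T → AddMonoidAlgebra R G) :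
    ofLaurent ∘ (D • v) = D • (ofLaurent ∘ v) :=
  (map_smul_comp (φ := RingHom.id (AddMonoidAlgebra R G)) (c := ofLaurent.toAddMonoidHom)
    ofLaurent.map_smul D v).symm

lemma coeff_matrix_smul (D : Matrix T T (AddMonoidAlgebra R G)) (v : T → AddMonoidAlgebra R G)
    (t : T) (g : G) : ((D • v) t).coeff g = (D • (ofLaurent ∘ v)) t g :=
  congrFun (congrFun (ofLaurent_comp_smul D v) t) g

lemma hasFinitePropagation_mulOp (D : Matrix T T (AddMonoidAlgebra R G)) :
    HasFinitePropagation π (mulOp Rᵐᵒᵖ D) := by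
  obtain ⟨M, -, hM⟩ := exists_support_bound (fun p : T × T => D p.1 p.2) π
  refine ⟨M, fun v t g h => ?_⟩
  rw [mulOp_apply, coeff_matrix_smul] at h
  obtain ⟨s, k, hk, hne⟩ := exists_ne_zero_of_smul_apply_ne_zero h
  exact ⟨s, g - k, hne, by rw [sub_sub_cancel]; exact hM (t, s) k hk⟩

lemma HasFinitePropagation.homotopyDefect (hf : HasFinitePropagation π f)
    (D : Matrix T T (AddMonoidAlgebra R G)) :
    HasFinitePropagation π (homotopyDefect (mulOp Rᵐᵒᵖ D) f) :=
  (hasFinitePropagation_one.sub ((hasFinitePropagation_mulOp D).mul hf)).sub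
    (hf.mul (hasFinitePropagation_mulOp D))

end Propagation

section ThinOperator

variable {R : Type u} [Ring R] {G T : Type*} [AddCommGroup G] [Fintype T]

lemma thinSeries_mul_thinHom (e : G ≃+ ℤ × ℤ) (b : ThinRing R) (l : AddMonoidAlgebra R G) (g : G) :
    thinSeries e (b * thinHom R e l) g
      = ∑ k ∈ l.coeff.support, thinSeries e b (g - k) * l.coeff k := by
  conv_lhs => rw [eq_sum_single l, map_sum, Finset.mul_sum, map_sum,
    FormalSeries.sum_apply]
  simp only [thinSeries_mul_single]

lemma op_smul_eq_mul_single {G : Type*} [AddMonoid G] (r : Rᵐᵒᵖ) (l : AddMonoidAlgebra R G) :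
    r • l = l * AddMonoidAlgebra.single 0 r.unop := by
  ext k
  rw [AddMonoidAlgebra.coeff_mul_single_zero, AddMonoidAlgebra.coeff_smul_apply]
  rfl

lemma thinSeries_mul_thinHom_smul (e : G ≃+ ℤ × ℤ) (b : ThinRing R) (r : Rᵐᵒᵖ)
    (l : AddMonoidAlgebra R G) :
    thinSeries e (b * thinHom R e (r • l)) = r • thinSeries e (b * thinHom R e l) := by
  ext g
  rw [op_smul_eq_mul_single, map_mul (thinHom R e), ← mul_assoc, thinSeries_mul_single, sub_zero]
  rfl

/-- The operator on vectors of Laurent polynomials given by a matrix over the thin ring, with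
formal series as values. -/
def thinOperator (e : G ≃+ ℤ × ℤ) (s : Matrix T T (ThinRing R)) :
    (T → AddMonoidAlgebra R G) →ₗ[Rᵐᵒᵖ] (T → FormalSeries R G) where
  toFun v t := ∑ t', thinSeries e (s t t' * thinHom R e (v t'))
  map_add' v w := funext fun t => by
    simp only [Pi.add_apply, map_add, mul_add, Finset.sum_add_distrib]
  map_smul' r v := funext fun t => by
    simp only [Pi.smul_apply, thinSeries_mul_thinHom_smul, Finset.smul_sum, RingHom.id_apply]

lemma exists_ne_zero_of_thinOperator_ne_zero {e : G ≃+ ℤ × ℤ} {s : Matrix T T (ThinRing R)}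
    {v : T → AddMonoidAlgebra R G} {t : T} {g : G} (h : thinOperator e s v t g ≠ 0) :
    ∃ t' k, (v t').coeff k ≠ 0 ∧ thinSeries e (s t t') (g - k) ≠ 0 := by
  change (∑ t', thinSeries e (s t t' * thinHom R e (v t'))) g ≠ 0 at h
  rw [FormalSeries.sum_apply] at h
  obtain ⟨t', -, ht'⟩ := Finset.exists_ne_zero_of_sum_ne_zero h
  rw [thinSeries_mul_thinHom] at ht'
  obtain ⟨k, hk, hne⟩ := Finset.exists_ne_zero_of_sum_ne_zero ht'
  exact ⟨t', k, Finsupp.mem_support_iff.1 hk, left_ne_zero_of_mul hne⟩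

variable [DecidableEq T]

lemma thinOperator_contraction {e : G ≃+ ℤ × ℤ} {D : Matrix T T (AddMonoidAlgebra R G)}
    {s : Matrix T T (ThinRing R)} (h : D.map (thinHom R e) * s + s * D.map (thinHom R e) = 1)
    (v : T → AddMonoidAlgebra R G) :
    D • thinOperator e s v + thinOperator e s (D • v) = ofLaurent ∘ v := by
  have thinOperator_eq (w : T → AddMonoidAlgebra R G) :
      thinOperator e s w = thinSeries e ∘ (s • (thinHom R e ∘ w)) :=
    funext fun t => (map_sum (thinSeries e) _ _).symm
  have hmap : thinHom R e ∘ (D • v) = D.map (thinHom R e) • (thinHom R e ∘ v) := by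
    ext1 t
    simp only [Function.comp_apply, Matrix.Module.smul_apply, smul_eq_mul, map_sum, map_mul,
      Matrix.map_apply]
  have hv := smul_add_smul_of_contraction h (thinHom R e ∘ v)
  rw [thinOperator_eq, thinOperator_eq, map_smul_comp (thinSeries_smul e), hmap]
  funext t
  rw [Pi.add_apply, Function.comp_apply, Function.comp_apply, ← map_add, ← Pi.add_apply, hv,
    Function.comp_apply, thinSeries_thinHom, Function.comp_apply]

end ThinOperator

section Strip

variable {R : Type u} [Ring R] {G T : Type*}

lemma exists_laurent_lift {V : Type*} [AddCommGroup V] [Module Rᵐᵒᵖ V]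
    (O : V →ₗ[Rᵐᵒᵖ] (T → FormalSeries R G)) (hO : ∀ v t, (Function.support (O v t)).Finite) :
    ∃ σ : V →ₗ[Rᵐᵒᵖ] (T → AddMonoidAlgebra R G), ∀ v t g, (σ v t).coeff g = O v t g :=
  ⟨{ toFun := fun v t => .ofCoeff (Finsupp.ofSupportFinite _ (hO v t))
     map_add' := fun v w => by
       ext t g
       exact congrFun (congrFun (map_add O v w) t) g
     map_smul' := fun r v => by
       ext t g
       exact congrFun (congrFun (map_smul O r v) t) g }, fun _ _ _ => rfl⟩

/-- The sign of the integer `-q`, with `-1` at `0`: it selects the one of two operators, with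
values bounded below and above, that is used for the coefficients at height `q`. -/
def oppositeSign (q : ℤ) : ℤˣ := if 0 ≤ q then -1 else 1

lemma oppositeSign_mul_nonpos (q : ℤ) : (oppositeSign q : ℤ) * q ≤ 0 := by
  rw [oppositeSign]
  split_ifs
  · simpa
  · simp only [Units.val_one, one_mul]
    omega

lemma oppositeSign_sub {N q k : ℤ} (hk : |k| ≤ N) (hq : N < |q|) :
    oppositeSign (q - k) = oppositeSign q := by
  rw [abs_le] at hk
  rw [oppositeSign, oppositeSign]
  congr 1
  rcases lt_abs.1 hq with h | h <;> exact propext ⟨fun _ => by omega, fun _ => by omega⟩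

variable [AddCommGroup G] [Fintype T]

/-- The projection of `G` onto the second coordinate of an identification with `ℤ × ℤ`. -/
abbrev heightHom (e : G ≃+ ℤ × ℤ) : G →+ ℤ := (AddMonoidHom.snd ℤ ℤ).comp e.toAddMonoidHom

/-- The projection of `G` onto the first coordinate of an identification with `ℤ × ℤ`. -/
abbrev widthHom (e : G ≃+ ℤ × ℤ) : G →+ ℤ := (AddMonoidHom.fst ℤ ℤ).comp e.toAddMonoidHom

lemma exists_thinOperator_bound (e : G ≃+ ℤ × ℤ) (s : Matrix T T (ThinRing R)) :
    ∃ m, ∀ v t g, thinOperator e s v t g ≠ 0 →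
      ∃ t' k, (v t').coeff k ≠ 0 ∧ |(e (g - k)).1| ≤ m ∧ -m ≤ (e (g - k)).2 := by
  choose m hm using fun p : T × T => mem_thinSubmodule.1 (thinSeries_mem e (s p.1 p.2))
  obtain ⟨M, hM⟩ := (Set.finite_range m).bddAbove
  refine ⟨M, fun v t g hg => ?_⟩
  obtain ⟨t', k, hk, hne⟩ := exists_ne_zero_of_thinOperator_ne_zero hg
  obtain ⟨h1, h2⟩ := hm (t, t') _ hne
  have hle : m (t, t') ≤ M := hM ⟨_, rfl⟩
  exact ⟨t', k, hk, h1.trans hle, (neg_le_neg hle).trans h2⟩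

lemma finite_thinOperator_nonpos (e : G ≃+ ℤ × ℤ) (s : Matrix T T (ThinRing R))
    (v : T → AddMonoidAlgebra R G) (t : T) :
    {g | (e g).2 ≤ 0 ∧ thinOperator e s v t g ≠ 0}.Finite := by
  obtain ⟨m, hm⟩ := exists_thinOperator_bound e s
  have hbox (k : G) :
      {g | (e g).2 ≤ 0 ∧ |(e (g - k)).1| ≤ m ∧ -m ≤ (e (g - k)).2}.Finite := by
    refine ((Set.finite_Icc ((e k).1 - m, (e k).2 - m) ((e k).1 + m, 0)).preimage
      e.injective.injOn).subset ?_
    rintro g ⟨h0, h1, h2⟩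
    simp only [map_sub e, Prod.fst_sub, Prod.snd_sub, abs_le] at h1 h2
    exact ⟨⟨by simp only; omega, by simp only; omega⟩, ⟨by simp only; omega, h0⟩⟩
  refine (Set.finite_iUnion fun t' => (v t').coeff.support.finite_toSet.biUnion
    fun k _ => hbox k).subset ?_
  rintro g ⟨h0, hne⟩
  obtain ⟨t', k, hk, hle⟩ := hm v t g hne
  exact Set.mem_iUnion.2 ⟨t', Set.mem_biUnion (Finsupp.mem_support_iff.2 hk) ⟨h0, hle⟩⟩

variable [DecidableEq T]

lemma exists_splice (π : G →+ ℤ) {D : Matrix T T (AddMonoidAlgebra R G)}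
    (O : ℤˣ → (T → AddMonoidAlgebra R G) →ₗ[Rᵐᵒᵖ] (T → FormalSeries R G))
    (hcontr : ∀ δ v, D • O δ v + O δ (D • v) = ofLaurent ∘ v)
    (hfin : ∀ (δ : ℤˣ) v t, {g | (δ : ℤ) * π g ≤ 0 ∧ O δ v t g ≠ 0}.Finite) :
    ∃ σ : Module.End Rᵐᵒᵖ (T → AddMonoidAlgebra R G),
      (∀ v t g, ∃ δ, (σ v t).coeff g = O δ v t g) ∧
      ∃ N, ∀ v t g, (homotopyDefect (mulOp Rᵐᵒᵖ D) σ v t).coeff g ≠ 0 → |π g| ≤ N := by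
  let spliced : (T → AddMonoidAlgebra R G) →ₗ[Rᵐᵒᵖ] (T → FormalSeries R G) :=
    { toFun := fun v t g => O (oppositeSign (π g)) v t g
      map_add' := fun v w => by
        ext t g
        exact congrFun (congrFun (map_add (O (oppositeSign (π g))) v w) t) g
      map_smul' := fun r v => by
        ext t g
        exact congrFun (congrFun (map_smul (O (oppositeSign (π g))) r v) t) g }
  obtain ⟨σ, hσ⟩ := exists_laurent_lift spliced fun v t =>
    (Set.finite_iUnion fun δ => hfin δ v t).subset fun g hg =>
      Set.mem_iUnion.2 ⟨oppositeSign (π g), oppositeSign_mul_nonpos _, hg⟩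
  refine ⟨σ, fun v t g => ⟨_, hσ v t g⟩, ?_⟩
  obtain ⟨N, -, hN⟩ := exists_support_bound (fun p : T × T => D p.1 p.2) π
  refine ⟨N, fun v t g => not_imp_comm.1 fun hg => ?_⟩
  have hDσ : ((D • σ v) t).coeff g = (D • O (oppositeSign (π g)) v) t g := by
    rw [coeff_matrix_smul]
    refine smul_apply_congr fun t' k hk => (hσ v t' (g - k)).trans ?_
    change O (oppositeSign (π (g - k))) v t' (g - k) = _
    rw [map_sub, oppositeSign_sub (hN (t, t') k hk) (not_le.1 hg)]
  have hσD : (σ (D • v) t).coeff g = O (oppositeSign (π g)) (D • v) t g := hσ _ _ _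
  have key := congrFun (congrFun (hcontr (oppositeSign (π g)) v) t) g
  change (v t).coeff g - ((D • σ v) t).coeff g - (σ (D • v) t).coeff g = 0
  rw [hDσ, hσD, sub_sub, sub_eq_zero]
  exact key.symm

variable {deg : T → ℤ} {D : Matrix T T (AddMonoidAlgebra R G)}

lemma exists_strip_homotopy (hD : IsGradedDifferential deg D) (e : G ≃+ ℤ × ℤ)
    (h : ∀ δ, IsExactOver (thinHom R (e.trans (signs 1 δ))) D) :
    ∃ σ : Module.End Rᵐᵒᵖ (T → AddMonoidAlgebra R G), HasFinitePropagation (widthHom e) σ ∧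
      ∃ N, ∀ v t g, (homotopyDefect (mulOp Rᵐᵒᵖ D) σ v t).coeff g ≠ 0 → |heightHom e g| ≤ N := by
  choose s hs using fun δ => (hD.map _).exists_contraction (h δ)
  choose m hm using fun δ => exists_thinOperator_bound (e.trans (signs 1 δ)) (s δ)
  obtain ⟨M, hM⟩ := (Set.finite_range m).bddAbove
  obtain ⟨σ, hσ, hdefect⟩ := exists_splice (heightHom e)
    (fun δ => thinOperator (e.trans (signs 1 δ)) (s δ))
    (fun δ => thinOperator_contraction (hs δ))
    fun (δ : ℤˣ) v t => (finite_thinOperator_nonpos (e.trans (signs 1 δ)) (s δ) v t).subset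
      fun g hg => ⟨hg.1, hg.2⟩
  refine ⟨σ, ⟨M, fun v t g hg => ?_⟩, hdefect⟩
  obtain ⟨δ, hδ⟩ := hσ v t g
  obtain ⟨t', k, hk, hle, -⟩ := hm δ v t g (hδ ▸ hg)
  refine ⟨t', k, hk, le_trans (le_of_eq ?_) (hle.trans (hM ⟨δ, rfl⟩))⟩
  simp [signs_apply]

end Strip

section HomotopyFinite

variable {R : Type u} [Ring R] {G T : Type*} [AddCommGroup G] [Fintype T] [DecidableEq T]

/-- A matrix `D` with `D * D = 0` is homotopy finite if, `R`-linearly, the identity of its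
complex is homotopic to an endomorphism whose values are all supported in one finite set. -/
def HomotopyFinite (D : Matrix T T (AddMonoidAlgebra R G)) : Prop :=
  ∃ (H : Module.End Rᵐᵒᵖ (T → AddMonoidAlgebra R G)) (A : Set (T × G)), A.Finite ∧
    ∀ v, homotopyDefect (mulOp Rᵐᵒᵖ D) H v ∈ supportedIn R A

lemma homotopyFinite_of_isExactOver_thinHom {deg : T → ℤ} {D : Matrix T T (LaurentPoly₂ R)}
    (hD : IsGradedDifferential deg D) (h : ∀ δ, IsExactOver (thinHom R (signs 1 δ)) D)
    (h' : ∀ ε, IsExactOver (thinHom R (swapSigns ε)) D) : HomotopyFinite D := by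
  have refl_trans (δ : ℤˣ) : (AddEquiv.refl _).trans (signs 1 δ) = signs 1 δ :=
    AddEquiv.ext fun _ => rfl
  obtain ⟨σ, -, N, hσ⟩ := exists_strip_homotopy hD (AddEquiv.refl _) fun δ =>
    (refl_trans δ).symm ▸ h δ
  obtain ⟨τ, hτ, N', hτ'⟩ := exists_strip_homotopy hD AddEquiv.prodComm h'
  obtain ⟨M, hM⟩ := hτ.homotopyDefect D
  refine ⟨τ + homotopyDefect (mulOp Rᵐᵒᵖ D) τ * σ,
    Set.univ ×ˢ Set.Icc (-N', -(M + N)) (N', M + N),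
    Set.finite_univ.prod (Set.finite_Icc _ _), fun v t g hg => ⟨trivial, ?_⟩⟩
  rw [homotopyDefect_add_mul (mulOp_mul_self hD.mul_self)] at hg
  obtain ⟨s, k, hk, hle⟩ := hM _ t g hg
  have h1 : |g.1| ≤ N' := hτ' _ t g hg
  have h2 : |k.2| ≤ N := hσ v s k hk
  change |(g - k).2| ≤ M at hle
  rw [Prod.snd_sub, abs_le] at hle
  rw [abs_le] at h1 h2
  exact ⟨⟨h1.1, by simp only; omega⟩, ⟨h1.2, by simp only; omega⟩⟩

end HomotopyFinite

section Translation

variable {R : Type u} [Ring R] {G T : Type*} [AddCommGroup G]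

/-- Multiplication of a vector of Laurent polynomials by the monomial `c`. -/
def mulMonomial (c : G) : Module.End Rᵐᵒᵖ (T → AddMonoidAlgebra R G) where
  toFun v t := AddMonoidAlgebra.single c 1 * v t
  map_add' v w := funext fun t => mul_add _ (v t) (w t)
  map_smul' r v := funext fun t => mul_smul_comm r _ (v t)

lemma coeff_mulMonomial (c : G) (v : T → AddMonoidAlgebra R G) (t : T) (g : G) :
    (mulMonomial c v t).coeff g = (v t).coeff (g - c) := by
  change (AddMonoidAlgebra.single c 1 * v t).coeff g = _
  rw [AddMonoidAlgebra.coeff_single_mul_apply, one_mul, neg_add_eq_sub]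

lemma mulMonomial_mul_neg (c : G) :
    mulMonomial c * mulMonomial (-c) = (1 : Module.End Rᵐᵒᵖ (T → AddMonoidAlgebra R G)) := by
  ext v t g
  rw [Module.End.mul_apply, coeff_mulMonomial, coeff_mulMonomial, sub_neg_eq_add, sub_add_cancel,
    Module.End.one_apply]

variable [Fintype T] [DecidableEq T]

lemma commute_mulOp_mulMonomial (D : Matrix T T (AddMonoidAlgebra R G)) (c : G) :
    Commute (mulOp Rᵐᵒᵖ D) (mulMonomial c) := by
  refine LinearMap.ext fun v => funext fun s => ?_
  change ∑ t, D s t * (AddMonoidAlgebra.single c 1 * v t)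
    = AddMonoidAlgebra.single c 1 * ∑ t, D s t * v t
  simp only [Finset.mul_sum, ← mul_assoc,
    (AddMonoidAlgebra.single_commute (AddCommute.all c) (Commute.one_left ·) (D s _)).eq]

end Translation

section HomotopyFiniteExact

lemma homotopyDefect_conj {A V : Type*} [Ring A] [AddCommGroup V] [Module A V]
    {d s s' : Module.End A V} (hs : s * s' = 1) (hd : Commute d s) (hd' : Commute d s')
    (h : Module.End A V) : homotopyDefect d (s * h * s') = s * homotopyDefect d h * s' := by
  simp only [homotopyDefect, mul_sub, sub_mul, mul_one, hs, mul_assoc, ← hd'.eq]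
  rw [← mul_assoc d s, hd.eq, mul_assoc]

lemma exists_telescoping {A V : Type*} [Ring A] [AddCommGroup V] [Module A V]
    {d : Module.End A V} (hd : d * d = 0) (h : ℕ → Module.End A V) {u : ℕ → V} (hu : u 0 = 0) :
    ∃ a : ℕ → V, a 0 = 0 ∧
      (∀ j, a (j + 1) = homotopyDefect d (h j) (a j) + h j (d (u j)) + (u (j + 1) - u j)) ∧
      ∀ n, d (∑ j ∈ Finset.range n, h j (a j)) = u n - a n := by
  -- The error `a j` left by the first `j` corrections is handed to `h j`; as `d a = d u`, what
  -- remains of it is its image under the homotopy defect, so the errors do not accumulate.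
  let a : ℕ → V := fun n => n.rec 0 fun j aj => aj - d (h j aj) + (u (j + 1) - u j)
  have ha (j : ℕ) : a (j + 1) = a j - d (h j (a j)) + (u (j + 1) - u j) := rfl
  have hdd (v : V) : d (d v) = 0 := LinearMap.congr_fun hd v
  have hda (j : ℕ) : d (a j) = d (u j) := by
    induction j with
    | zero => exact congrArg d hu.symm
    | succ j ih => rw [ha, map_add, map_sub, map_sub, hdd, ih, sub_zero, add_sub_cancel]
  refine ⟨a, rfl, fun j => ?_, fun n => ?_⟩
  · rw [ha, ← hda]
    change _ = a j - d (h j (a j)) - h j (d (a j)) + h j (d (a j)) + _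
    rw [sub_add_cancel]
  · have hsum : d (∑ j ∈ Finset.range n, h j (a j))
        = ∑ j ∈ Finset.range n, ((u (j + 1) - a (j + 1)) - (u j - a j)) := by
      rw [map_sum]
      exact Finset.sum_congr rfl fun j _ => by rw [ha]; abel
    rw [hsum, Finset.sum_range_sub (fun j => u j - a j) n, hu]
    change _ - (0 - 0) = _
    rw [sub_zero, sub_zero]

variable {R : Type u} [Ring R] {G T : Type*} [AddCommGroup G]

/-- The vectors of Laurent polynomials with support in the square of radius `M` around `(0, j)`,
for an identification `e` of the exponents with `ℤ × ℤ`. -/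
def box (R : Type u) [Ring R] (T : Type*) (e : G ≃+ ℤ × ℤ) (M j : ℤ) :
    Submodule Rᵐᵒᵖ (T → AddMonoidAlgebra R G) :=
  supportedIn R {p | |(e p.2).1| ≤ M ∧ |(e p.2).2 - j| ≤ M}

variable {e : G ≃+ ℤ × ℤ}

lemma mem_box {M j : ℤ} {v : T → AddMonoidAlgebra R G} :
    v ∈ box R T e M j ↔ ∀ t g, (v t).coeff g ≠ 0 → |(e g).1| ≤ M ∧ |(e g).2 - j| ≤ M := Iff.rfl

lemma box_mono {M M' : ℤ} (h : M ≤ M') (j : ℤ) : box R T e M j ≤ box R T e M' j :=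
  supportedIn_mono fun _ hp => ⟨hp.1.trans h, hp.2.trans h⟩

lemma mulMonomial_mem_box {M i j : ℤ} {v : T → AddMonoidAlgebra R G} (hv : v ∈ box R T e M j) :
    mulMonomial (e.symm (0, i)) v ∈ box R T e M (j + i) := fun t g hg => by
  rw [coeff_mulMonomial] at hg
  simpa [sub_sub, add_comm i j] using hv t _ hg

lemma exists_supportedIn_le_box {A : Set (T × G)} (hA : A.Finite) :
    ∃ M, supportedIn R A ≤ box R T e M 0 := by
  obtain ⟨M, hM⟩ := (hA.image fun p => max |(e p.2).1| |(e p.2).2|).bddAbove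
  refine ⟨M, supportedIn_mono fun p hp => ?_⟩
  rw [Set.mem_ofPred_eq, sub_zero, ← max_le_iff]
  exact hM ⟨p, hp, rfl⟩

lemma exists_truncations (e : G ≃+ ℤ × ℤ) {v : T → FormalSeries R G} {m : ℤ}
    (hv : ∀ t g, v t g ≠ 0 → |(e g).1| ≤ m ∧ -m ≤ (e g).2) :
    ∃ u : ℕ → T → AddMonoidAlgebra R G, ∀ j t g,
      (u j t).coeff g = if (e g).2 < j - m then v t g else 0 := by
  have hfin (j : ℕ) (t : T) :
      (Function.support fun g => if (e g).2 < j - m then v t g else 0).Finite := by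
    refine ((Set.finite_Icc (-m, -m) (m, j - m)).preimage e.injective.injOn).subset fun g hg => ?_
    obtain ⟨hj, hvg⟩ := ite_ne_right_iff.1 hg
    obtain ⟨h1, h2⟩ := hv t g hvg
    exact ⟨⟨(abs_le.1 h1).1, h2⟩, ⟨(abs_le.1 h1).2, hj.le⟩⟩
  exact ⟨fun j t => .ofCoeff (Finsupp.ofSupportFinite _ (hfin j t)), fun _ _ _ => rfl⟩

lemma truncation_succ_sub_mem_box {v : T → FormalSeries R G} {m : ℤ}
    (hv : ∀ t g, v t g ≠ 0 → |(e g).1| ≤ m ∧ -m ≤ (e g).2) {u : ℕ → T → AddMonoidAlgebra R G}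
    (hu : ∀ j t g, (u j t).coeff g = if (e g).2 < j - m then v t g else 0) (j : ℕ) :
    u (j + 1) - u j ∈ box R T e |m| j := mem_box.2 fun t g hg => by
  rw [Pi.sub_apply, AddMonoidAlgebra.coeff_sub, Finsupp.sub_apply, hu, hu] at hg
  have := le_abs_self m
  have := neg_abs_le m
  push_cast at hg
  split_ifs at hg
  · exact absurd (sub_self _) hg
  · exact ⟨(hv t g (by simpa using hg)).1.trans (le_abs_self m), abs_le.2 ⟨by omega, by omega⟩⟩
  · omega
  · exact absurd (sub_self _) hg

lemma exists_thin_sum {b : ℕ → T → AddMonoidAlgebra R G} {M : ℤ}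
    (hb : ∀ j : ℕ, b j ∈ box R T e M j) :
    ∃ w : T → FormalSeries R G, (∀ t, w t ∈ thinSubmodule R e) ∧
      ∀ t g (n : ℕ), (e g).2 + M < n → w t g = ((∑ j ∈ Finset.range n, b j) t).coeff g := by
  let w (t : T) (g : G) : R := ∑ j ∈ Finset.range ((e g).2 + M + 1).toNat, (b j t).coeff g
  refine ⟨w, fun t => mem_thinSubmodule.2 ⟨M, fun g hg => ?_⟩, fun t g n hn => ?_⟩
  · obtain ⟨j, -, hj⟩ := Finset.exists_ne_zero_of_sum_ne_zero hg
    obtain ⟨h1, h2⟩ := mem_box.1 (hb j) t g hj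
    rw [abs_le] at h2
    exact ⟨h1, by omega⟩
  · rw [Finset.sum_apply, AddMonoidAlgebra.coeff_sum, Finsupp.finsetSum_apply]
    refine Finset.sum_subset (fun j hj => ?_) fun j _ hj => ?_
    · rw [Finset.mem_range] at hj ⊢
      omega
    · rw [Finset.mem_range] at hj
      by_contra hne
      have h2 := abs_le.1 (mem_box.1 (hb j) t g hne).2
      omega

lemma finite_box [Finite T] (e : G ≃+ ℤ × ℤ) (M : ℤ) :
    {p : T × G | |(e p.2).1| ≤ M ∧ |(e p.2).2 - 0| ≤ M}.Finite := by
  refine (Set.finite_univ.prod ((Set.finite_Icc (-M, -M) (M, M)).preimage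
    e.injective.injOn)).subset fun p hp => ⟨trivial, ?_⟩
  simp only [Set.mem_ofPred_eq, sub_zero, abs_le] at hp
  exact ⟨⟨hp.1.1, hp.2.1⟩, ⟨hp.1.2, hp.2.2⟩⟩

variable [Fintype T] [DecidableEq T] {D : Matrix T T (AddMonoidAlgebra R G)}

lemma HomotopyFinite.exists_translates (h : HomotopyFinite D) (e : G ≃+ ℤ × ℤ) :
    ∃ H : ℕ → Module.End Rᵐᵒᵖ (T → AddMonoidAlgebra R G),
      (∃ M, ∀ (j : ℕ) v, homotopyDefect (mulOp Rᵐᵒᵖ D) (H j) v ∈ box R T e M j) ∧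
      ∀ M, ∃ M', ∀ j : ℕ, ∀ v ∈ box R T e M j, H j v ∈ box R T e M' j := by
  obtain ⟨H, A, hA, hH⟩ := h
  let c (j : ℕ) : G := e.symm (0, j)
  have shift_back {M : ℤ} {j : ℕ} {v : T → AddMonoidAlgebra R G}
      (hv : v ∈ box R T e M 0) : mulMonomial (c j) v ∈ box R T e M j :=
    zero_add (j : ℤ) ▸ mulMonomial_mem_box hv
  refine ⟨fun j => mulMonomial (c j) * H * mulMonomial (-c j), ?_, fun M => ?_⟩
  · obtain ⟨M, hM⟩ := exists_supportedIn_le_box (R := R) (e := e) hA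
    refine ⟨M, fun j v => ?_⟩
    rw [homotopyDefect_conj (mulMonomial_mul_neg _) (commute_mulOp_mulMonomial _ _)
      (commute_mulOp_mulMonomial _ _)]
    exact shift_back (hM (hH _))
  · obtain ⟨B, hB, hHB⟩ := exists_map_supportedIn_le H (finite_box (T := T) e M)
    obtain ⟨M', hM'⟩ := exists_supportedIn_le_box (R := R) (e := e) hB
    refine ⟨M', fun j v hv => shift_back (hM' (hHB _ ?_))⟩
    have hneg : -c j = e.symm (0, -j) := by
      rw [← map_neg e.symm, Prod.neg_mk, neg_zero]
    have hmem := mulMonomial_mem_box (i := -(j : ℤ)) hv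
    rwa [add_neg_cancel, ← hneg] at hmem

lemma exists_mulOp_truncation_mem_box {v : T → FormalSeries R G} {m : ℤ}
    (hv : ∀ t g, v t g ≠ 0 → |(e g).1| ≤ m ∧ -m ≤ (e g).2) (hDv : D • v = 0)
    {u : ℕ → T → AddMonoidAlgebra R G}
    (hu : ∀ j t g, (u j t).coeff g = if (e g).2 < j - m then v t g else 0) :
    ∃ M, ∀ j : ℕ, mulOp Rᵐᵒᵖ D (u j) ∈ box R T e M j := by
  obtain ⟨N, -, hN⟩ := exists_support_bound (fun p : T × T => D p.1 p.2) (heightHom e)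
  obtain ⟨N', -, hN'⟩ := exists_support_bound (fun p : T × T => D p.1 p.2) (widthHom e)
  refine ⟨|m| + N + N', fun j => mem_box.2 fun t g hg => ?_⟩
  rw [mulOp_apply, coeff_matrix_smul] at hg
  obtain ⟨s, k, hk, hne⟩ := exists_ne_zero_of_smul_apply_ne_zero hg
  obtain ⟨hlt, hvne⟩ := ite_ne_right_iff.1 ((hu j s (g - k)).symm.trans_ne hne)
  have hwidth := (hv s _ hvne).1
  have hk1 : |(e k).1| ≤ N' := hN' (t, s) k hk
  have hk2 : |(e k).2| ≤ N := hN (t, s) k hk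
  have hlow : j - m ≤ (e g).2 + N := by
    by_contra! hlow
    refine hg ((smul_apply_congr fun s' k' hk' => ?_).trans (congrFun (congrFun hDv t) g))
    have hk2' : |(e k').2| ≤ N := hN (t, s') k' hk'
    refine (hu j s' (g - k')).trans (if_pos ?_)
    rw [map_sub, Prod.snd_sub]
    rw [abs_le] at hk2'
    omega
  rw [map_sub e] at hlt hwidth
  simp only [Prod.fst_sub, Prod.snd_sub, abs_le] at hlt hwidth hk1 hk2
  simp only [abs_le]
  have := le_abs_self m
  have := neg_abs_le m
  refine ⟨⟨?_, ?_⟩, ?_, ?_⟩ <;> omega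

lemma HomotopyFinite.exists_primitives (h : HomotopyFinite D) (hD : D * D = 0)
    {v : T → FormalSeries R G} {m : ℤ} (hv : ∀ t g, v t g ≠ 0 → |(e g).1| ≤ m ∧ -m ≤ (e g).2)
    (hDv : D • v = 0) {u : ℕ → T → AddMonoidAlgebra R G}
    (hu : ∀ j t g, (u j t).coeff g = if (e g).2 < j - m then v t g else 0) :
    ∃ (b : ℕ → T → AddMonoidAlgebra R G) (M : ℤ), (∀ j : ℕ, b j ∈ box R T e M j) ∧
      ∀ n : ℕ, u n - mulOp Rᵐᵒᵖ D (∑ j ∈ Finset.range n, b j) ∈ box R T e M n := by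
  obtain ⟨H, ⟨M₁, hM₁⟩, hH⟩ := h.exists_translates e
  obtain ⟨M₂, hM₂⟩ := exists_mulOp_truncation_mem_box hv hDv hu
  obtain ⟨M₃, hM₃⟩ := hH M₂
  have hu0 : u 0 = 0 := by
    ext t g
    rw [hu]
    exact ite_eq_right_iff.2 fun hlt => by_contra fun hne => by
      have := (hv t g hne).2
      omega
  obtain ⟨a, ha0, hstep, hsum⟩ := exists_telescoping (mulOp_mul_self hD) H hu0
  let M := max M₁ (max M₃ |m|) + 1
  have ha (j : ℕ) : a j ∈ box R T e M j := by
    cases j with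
    | zero => exact ha0 ▸ zero_mem _
    | succ j =>
      have hj : a (j + 1) ∈ box R T e (max M₁ (max M₃ |m|)) j := hstep j ▸ add_mem (add_mem
        (box_mono (by omega) j (hM₁ j _)) (box_mono (by omega) j (hM₃ j _ (hM₂ j))))
        (box_mono (by omega) j (truncation_succ_sub_mem_box hv hu j))
      refine mem_box.2 fun t g hg => ?_
      obtain ⟨h1, h2⟩ := mem_box.1 hj t g hg
      rw [abs_le] at h2
      exact ⟨h1.trans (Int.le_add_one le_rfl), abs_le.2 ⟨by push_cast; omega, by push_cast; omega⟩⟩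
  obtain ⟨M', hM'⟩ := hH M
  refine ⟨fun j => H j (a j), max M M', fun j => box_mono (le_max_right _ _) j (hM' j _ (ha j)),
    fun n => ?_⟩
  rw [hsum, sub_sub_cancel]
  exact box_mono (le_max_left _ _) n (ha n)

lemma HomotopyFinite.isExactOver_thinHom (h : HomotopyFinite D) (hD : D * D = 0)
    (e : G ≃+ ℤ × ℤ) : IsExactOver (thinHom R e) D := by
  rw [isExactOver_thinHom_iff]
  intro v hv hDv
  obtain ⟨m, hm⟩ : ∃ m, ∀ t g, v t g ≠ 0 → |(e g).1| ≤ m ∧ -m ≤ (e g).2 := by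
    choose m hm using fun t => mem_thinSubmodule.1 (hv t)
    obtain ⟨M, hM⟩ := (Set.finite_range m).bddAbove
    have hle (t : T) : m t ≤ M := hM ⟨t, rfl⟩
    exact ⟨M, fun t g hg => ⟨(hm t g hg).1.trans (hle t),
      (neg_le_neg (hle t)).trans (hm t g hg).2⟩⟩
  obtain ⟨u, hu⟩ := exists_truncations e hm
  obtain ⟨b, M, hb, hub⟩ := h.exists_primitives hD hm hDv hu
  obtain ⟨w, hw, hwb⟩ := exists_thin_sum hb
  obtain ⟨N, hN0, hN⟩ := exists_support_bound (fun p : T × T => D p.1 p.2) (heightHom e)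
  refine ⟨w, hw, funext fun t => FormalSeries.ext fun g => ?_⟩
  obtain ⟨n, hn⟩ : ∃ n : ℕ, |(e g).2| + |M| + |m| + N < n :=
    ⟨(|(e g).2| + |M| + |m| + N + 1).toNat, by omega⟩
  have := le_abs_self (e g).2
  have := le_abs_self M
  have := le_abs_self m
  have := abs_nonneg m
  have := abs_nonneg M
  have hDw : (D • w) t g = (mulOp Rᵐᵒᵖ D (∑ j ∈ Finset.range n, b j) t).coeff g := by
    rw [mulOp_apply, coeff_matrix_smul]
    refine smul_apply_congr fun s k hk => hwb s (g - k) n ?_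
    have hk2 : |(e k).2| ≤ N := hN (t, s) k hk
    rw [abs_le] at hk2
    rw [map_sub e, Prod.snd_sub]
    omega
  have hun : (u n t).coeff g = v t g := (hu n t g).trans (if_pos (by omega))
  have hrest : ((u n - mulOp Rᵐᵒᵖ D (∑ j ∈ Finset.range n, b j)) t).coeff g = 0 := by
    by_contra hne
    have := abs_le.1 (mem_box.1 (hub n) t g hne).2
    omega
  rw [Pi.sub_apply, AddMonoidAlgebra.coeff_sub, Finsupp.sub_apply, hun, sub_eq_zero] at hrest
  rw [hDw, hrest]

end HomotopyFiniteExact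

section Totalization

variable {𝒞 : Type*} [Category 𝒞] [Preadditive 𝒞]

/-- A realisation of `V`, with the endomorphism `d`, as the direct sum of the components of a
cochain complex `K` with finitely many nonzero components, with its total differential. -/
structure Totalization (K : CochainComplex 𝒞 ℤ) {V : 𝒞} (d : V ⟶ V) where
  /-- The inclusion of the component of degree `n`. -/
  incl (n : ℤ) : K.X n ⟶ V
  /-- The projection to the component of degree `n`. -/
  proj (n : ℤ) : V ⟶ K.X n
  /-- A finite set of degrees that contains those of the nonzero components. -/
  degrees : Finset ℤ
  incl_proj (n : ℤ) : incl n ≫ proj n = 𝟙 (K.X n)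
  incl_proj_of_ne {n m : ℤ} (h : n ≠ m) : incl n ≫ proj m = 0
  sum_proj_incl : ∑ n ∈ degrees, proj n ≫ incl n = 𝟙 V
  incl_d (n : ℤ) : incl n ≫ d = K.d n (n + 1) ≫ incl (n + 1)

namespace Totalization

variable {K : CochainComplex 𝒞 ℤ} {V : 𝒞} {d : V ⟶ V} (τ : Totalization K d)

lemma incl_eq_zero {n : ℤ} (hn : n ∉ τ.degrees) : τ.incl n = 0 := by
  rw [← Category.comp_id (τ.incl n), ← τ.sum_proj_incl, Preadditive.comp_sum]
  refine Finset.sum_eq_zero fun m hm => ?_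
  have hnm : n ≠ m := fun h => hn (h ▸ hm)
  rw [← Category.assoc, τ.incl_proj_of_ne hnm, Limits.zero_comp]

lemma isZero_of_notMem_degrees {n : ℤ} (hn : n ∉ τ.degrees) : Limits.IsZero (K.X n) := by
  rw [Limits.IsZero.iff_id_eq_zero, ← τ.incl_proj, τ.incl_eq_zero hn, Limits.zero_comp]

include τ in
lemma hom_ext {W : 𝒞} {f g : V ⟶ W}
    (h : ∀ n, τ.incl n ≫ f = τ.incl n ≫ g) : f = g := by
  rw [← Category.id_comp f, ← Category.id_comp g, ← τ.sum_proj_incl, Preadditive.sum_comp,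
    Preadditive.sum_comp]
  exact Finset.sum_congr rfl fun n _ => by rw [Category.assoc, h, Category.assoc]

lemma d_proj (n : ℤ) : d ≫ τ.proj (n + 1) = τ.proj n ≫ K.d n (n + 1) :=
  τ.hom_ext fun m => by
    rw [← Category.assoc, τ.incl_d, Category.assoc, ← Category.assoc (τ.incl m)]
    obtain rfl | h := eq_or_ne m n
    · rw [τ.incl_proj, τ.incl_proj, Category.comp_id, Category.id_comp]
    · rw [τ.incl_proj_of_ne h, τ.incl_proj_of_ne (by omega), Limits.comp_zero, Limits.zero_comp]

include τ in
lemma d_comp_d : d ≫ d = 0 :=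
  τ.hom_ext fun n => by
    rw [← Category.assoc, τ.incl_d, Category.assoc, τ.incl_d, K.d_comp_d_assoc, Limits.zero_comp,
      Limits.comp_zero]

/-- The image of a totalization under an additive functor. -/
def map {𝒟 : Type*} [Category 𝒟] [Preadditive 𝒟] (F : 𝒞 ⥤ 𝒟) [F.Additive] :
    Totalization ((F.mapHomologicalComplex (ComplexShape.up ℤ)).obj K) (F.map d) where
  incl n := F.map (τ.incl n)
  proj n := F.map (τ.proj n)
  degrees := τ.degrees
  incl_proj n :=
    (F.map_comp _ _).symm.trans ((congrArg F.map (τ.incl_proj n)).trans (F.map_id _))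
  incl_proj_of_ne h :=
    (F.map_comp _ _).symm.trans ((congrArg F.map (τ.incl_proj_of_ne h)).trans (F.map_zero _ _))
  sum_proj_incl := by
    rw [← F.map_id, ← τ.sum_proj_incl, F.map_sum]
    exact Finset.sum_congr rfl fun n _ => (F.map_comp _ _).symm
  incl_d n := (F.map_comp _ _).symm.trans ((congrArg F.map (τ.incl_d n)).trans (F.map_comp _ _))

/-- The transport of a totalization along an isomorphism. -/
def ofIso {V' : 𝒞} {d' : V' ⟶ V'} (e : V ≅ V') (h : d ≫ e.hom = e.hom ≫ d') :
    Totalization K d' where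
  incl n := τ.incl n ≫ e.hom
  proj n := e.inv ≫ τ.proj n
  degrees := τ.degrees
  incl_proj n := by rw [Category.assoc, e.hom_inv_id_assoc, τ.incl_proj]
  incl_proj_of_ne h := by rw [Category.assoc, e.hom_inv_id_assoc, τ.incl_proj_of_ne h]
  sum_proj_incl := by
    simp only [Category.assoc, ← Preadditive.comp_sum]
    simp only [← Category.assoc (τ.proj _), ← Preadditive.sum_comp, τ.sum_proj_incl,
      Category.id_comp, e.inv_hom_id]
  incl_d n := by rw [Category.assoc, ← h, ← Category.assoc, τ.incl_d, Category.assoc]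

/-- The endomorphism of `V` given by maps that lower the degree in `K` by one. -/
def lift (ψ : ∀ n, K.X (n + 1) ⟶ K.X n) : V ⟶ V :=
  ∑ n ∈ τ.degrees, τ.proj (n + 1) ≫ ψ n ≫ τ.incl n

lemma incl_lift (ψ : ∀ n, K.X (n + 1) ⟶ K.X n) (n : ℤ) :
    τ.incl (n + 1) ≫ τ.lift ψ = ψ n ≫ τ.incl n := by
  rw [lift, Preadditive.comp_sum, Finset.sum_eq_single n]
  · rw [← Category.assoc, τ.incl_proj, Category.id_comp]
  · intro m _ hm
    rw [← Category.assoc, τ.incl_proj_of_ne (by omega), Limits.zero_comp]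
  · intro hn
    rw [τ.incl_eq_zero hn, Limits.comp_zero, Limits.comp_zero, Limits.comp_zero]

lemma incl_defect_lift (ψ : ∀ n, K.X (n + 1) ⟶ K.X n) (n : ℤ) :
    τ.incl (n + 1) ≫ (𝟙 V - τ.lift ψ ≫ d - d ≫ τ.lift ψ)
      = (𝟙 _ - ψ n ≫ K.d n (n + 1) - K.d (n + 1) (n + 1 + 1) ≫ ψ (n + 1)) ≫ τ.incl (n + 1) := by
  have h₁ := τ.incl_lift ψ n
  have h₂ := τ.incl_lift ψ (n + 1)
  simp only [Preadditive.comp_sub, Preadditive.sub_comp, Category.comp_id, Category.id_comp,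
    Category.assoc]
  rw [reassoc_of% h₁, τ.incl_d, reassoc_of% τ.incl_d (n + 1), h₂]

lemma exists_lift_of_homotopy {f : K ⟶ K} (s : Homotopy (𝟙 K) f) :
    ∃ h : V ⟶ V, ∀ n, τ.incl n ≫ (𝟙 V - h ≫ d - d ≫ h) = f.f n ≫ τ.incl n := by
  refine ⟨τ.lift fun n => s.hom (n + 1) n, fun n => ?_⟩
  obtain ⟨n, rfl⟩ : ∃ m, n = m + 1 := ⟨n - 1, by omega⟩
  have hs := s.comm (n + 1)
  rw [dNext_eq _ (show (ComplexShape.up ℤ).Rel (n + 1) (n + 1 + 1) by simp),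
    prevD_eq _ (show (ComplexShape.up ℤ).Rel n (n + 1) by simp), HomologicalComplex.id_f] at hs
  rw [incl_defect_lift, hs]
  congr 1
  abel

lemma exists_lowering (H : V ⟶ V) :
    ∃ h : V ⟶ V, (∀ n, ∃ ψ : K.X (n + 1) ⟶ K.X n, τ.incl (n + 1) ≫ h = ψ ≫ τ.incl n) ∧
      ∀ n, τ.incl n ≫ (𝟙 V - h ≫ d - d ≫ h)
        = τ.incl n ≫ (𝟙 V - H ≫ d - d ≫ H) ≫ τ.proj n ≫ τ.incl n := by
  refine ⟨τ.lift fun n => τ.incl (n + 1) ≫ H ≫ τ.proj n, fun n => ⟨_, τ.incl_lift _ n⟩,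
    fun n => ?_⟩
  obtain ⟨n, rfl⟩ : ∃ m, n = m + 1 := ⟨n - 1, by omega⟩
  rw [incl_defect_lift, ← Category.assoc (𝟙 V - _ - _), ← Category.assoc (τ.incl _) (_ ≫ _)]
  congr 1
  simp only [Preadditive.comp_sub, Preadditive.sub_comp, Category.id_comp, Category.assoc,
    τ.incl_proj, τ.d_proj, reassoc_of% τ.incl_d (n + 1)]

end Totalization

end Totalization

section ModuleTotalization

variable {S : Type*} [Ring S] {K : CochainComplex (ModuleCat S) ℤ}

lemma acyclic_iff_forall_exists :
    K.Acyclic ↔ ∀ n (x : K.X (n + 1)), K.d (n + 1) (n + 1 + 1) x = 0 →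
      ∃ y : K.X n, K.d n (n + 1) y = x := by
  have exactAt_iff (n : ℤ) : K.ExactAt (n + 1) ↔ ∀ x : K.X (n + 1),
      K.d (n + 1) (n + 1 + 1) x = 0 → ∃ y : K.X n, K.d n (n + 1) y = x := by
    rw [K.exactAt_iff' n (n + 1) (n + 1 + 1) (by simp) (by simp), ShortComplex.moduleCat_exact_iff]
    rfl
  refine ⟨fun h n => (exactAt_iff n).1 (h _), fun h n => ?_⟩
  obtain ⟨m, rfl⟩ : ∃ m, n = m + 1 := ⟨n - 1, by omega⟩
  exact (exactAt_iff m).2 (h m)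

namespace Totalization

variable {V : ModuleCat S} {d : V ⟶ V} (τ : Totalization K d)

lemma proj_incl_apply (n : ℤ) (x : K.X n) : τ.proj n (τ.incl n x) = x :=
  ConcreteCategory.congr_hom (τ.incl_proj n) x

lemma incl_injective (n : ℤ) : Function.Injective (τ.incl n) :=
  Function.LeftInverse.injective (τ.proj_incl_apply n)

lemma incl_d_apply (n : ℤ) (x : K.X n) : τ.incl (n + 1) (K.d n (n + 1) x) = d (τ.incl n x) :=
  (ConcreteCategory.congr_hom (τ.incl_d n) x).symm

lemma proj_d_apply (n : ℤ) (v : V) : τ.proj (n + 1) (d v) = K.d n (n + 1) (τ.proj n v) :=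
  ConcreteCategory.congr_hom (τ.d_proj n) v

lemma sum_incl_proj_apply (v : V) : ∑ n ∈ τ.degrees, τ.incl n (τ.proj n v) = v := by
  have h := ConcreteCategory.congr_hom τ.sum_proj_incl v
  simpa using h

include τ in
lemma acyclic_iff : K.Acyclic ↔ ∀ v, d v = 0 → ∃ w, d w = v := by
  rw [acyclic_iff_forall_exists]
  refine ⟨fun h v hv => ?_, fun h n x hx => ?_⟩
  · have exists_primitive (n : ℤ) : ∃ w, d w = τ.incl n (τ.proj n v) := by
      obtain ⟨m, rfl⟩ : ∃ m, n = m + 1 := ⟨n - 1, by omega⟩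
      obtain ⟨y, hy⟩ := h m (τ.proj (m + 1) v) (by rw [← τ.proj_d_apply, hv, map_zero])
      exact ⟨τ.incl m y, by rw [← τ.incl_d_apply, hy]⟩
    choose w hw using exists_primitive
    exact ⟨∑ n ∈ τ.degrees, w n, by
      rw [map_sum, Finset.sum_congr rfl fun n _ => hw n, τ.sum_incl_proj_apply]⟩
  · obtain ⟨w, hw⟩ := h (τ.incl (n + 1) x) (by rw [← τ.incl_d_apply, hx, map_zero])
    exact ⟨τ.proj n w, by rw [← τ.proj_d_apply, hw, τ.proj_incl_apply]⟩

end Totalization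

end ModuleTotalization

section MatrixPresentation

variable {A : Type u} [Ring A] {T : Type} [Fintype T] [DecidableEq T]

/-- A description of a cochain complex of right modules by a matrix: the total differential of the
complex is the action of the matrix `D` on the vectors indexed by a finite set `T` of graded basis
elements. -/
structure MatrixPresentation (C : CochainComplex (ModuleCat.{u} Aᵐᵒᵖ) ℤ) (T : Type) [Fintype T]
    [DecidableEq T] where
  /-- The degrees of the basis elements. -/
  deg : T → ℤ
  /-- The matrix of the differential. -/
  D : Matrix T T A
  /-- The identification of the direct sum of the components with the vectors. -/
  tot : Totalization C (V := ModuleCat.of Aᵐᵒᵖ (T → A)) (ModuleCat.ofHom (mulOp Aᵐᵒᵖ D))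
  incl_proj_apply (n : ℤ) (v : T → A) (t : T) :
    (tot.incl n).hom ((tot.proj n).hom v) t = if deg t = n then v t else 0

lemma sum_single_op_smul (v : T → A) :
    ∑ t, MulOpposite.op (v t) • (Pi.single t (1 : A) : T → A) = v := by
  ext s
  rw [Finset.sum_apply, Finset.sum_eq_single s]
  · simp
  · intro t _ h
    simp [Pi.single_eq_of_ne h.symm]
  · simp

lemma exists_mulOp_eq (f : Module.End Aᵐᵒᵖ (T → A)) : ∃ D : Matrix T T A, mulOp Aᵐᵒᵖ D = f := by
  refine ⟨.of fun s t => f (Pi.single t 1) s, LinearMap.ext fun v => funext fun s => ?_⟩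
  conv_rhs => rw [← sum_single_op_smul v, map_sum, Finset.sum_apply]
  simp only [map_smul]
  rfl

lemma exists_linearEquiv_pi (M : Type*) [AddCommGroup M] [Module Aᵐᵒᵖ M] [Module.Finite Aᵐᵒᵖ M]
    [Module.Free Aᵐᵒᵖ M] : ∃ k : ℕ, Nonempty (M ≃ₗ[Aᵐᵒᵖ] (Fin k → A)) := by
  let op : Aᵐᵒᵖ ≃ₗ[Aᵐᵒᵖ] A :=
    { MulOpposite.opAddEquiv.symm with map_smul' := fun r x => by simp }
  let b := Module.Free.chooseBasis Aᵐᵒᵖ M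
  exact ⟨_, ⟨(b.reindex (Fintype.equivFin _)).equivFun.trans
    (LinearEquiv.piCongrRight fun _ => op)⟩⟩

lemma IsBoundedComplex.exists_finset {C : CochainComplex (ModuleCat.{u} A) ℤ}
    (hC : IsBoundedComplex C) :
    ∃ I : Finset ℤ, ∀ n ∉ I, Limits.IsZero (C.X n) := by
  obtain ⟨a, b, hGE, hLE⟩ := hC
  refine ⟨Finset.Icc a b, fun n hn => ?_⟩
  rw [Finset.mem_Icc, not_and_or, not_le, not_le] at hn
  exact hn.elim (fun h => C.isZero_of_isStrictlyGE a n h) fun h => C.isZero_of_isStrictlyLE b n h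

section Construction

variable {C : CochainComplex (ModuleCat.{u} Aᵐᵒᵖ) ℤ} {I : Finset ℤ} {k : ℤ → ℕ}
  (e : ∀ n, C.X n ≃ₗ[Aᵐᵒᵖ] (Fin (k n) → A))

/-- The inclusion of the component of degree `n` into the vectors indexed by all basis elements
of the components with degrees in `I`. -/
def basisIncl (n : ℤ) : C.X n →ₗ[Aᵐᵒᵖ] ((Σ m : I, Fin (k m)) → A) :=
  LinearMap.pi fun t => LinearMap.proj t.2 ∘ₗ (e t.1).toLinearMap ∘ₗ LinearMap.proj (t.1 : ℤ) ∘ₗ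
    LinearMap.single Aᵐᵒᵖ (fun m => C.X m) n

/-- The projection onto the component of degree `n` from the vectors indexed by all basis elements
of the components with degrees in `I`. -/
def basisProj (n : ℤ) : ((Σ m : I, Fin (k m)) → A) →ₗ[Aᵐᵒᵖ] C.X n :=
  if h : n ∈ I then
    (e n).symm.toLinearMap ∘ₗ LinearMap.pi fun i => LinearMap.proj ⟨⟨n, h⟩, i⟩
  else 0

lemma basisProj_apply {n : ℤ} (h : n ∈ I) (v : (Σ m : I, Fin (k m)) → A) :
    basisProj e n v = (e n).symm fun i => v ⟨⟨n, h⟩, i⟩ := by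
  rw [basisProj, dif_pos h]
  rfl

lemma basisIncl_of_ne {n : ℤ} (c : C.X n) (t : Σ m : I, Fin (k m)) (h : (t.1 : ℤ) ≠ n) :
    basisIncl e n c t = 0 := by
  change e t.1 (Pi.single (M := fun m => C.X m) n c (t.1 : ℤ)) t.2 = 0
  rw [Pi.single_eq_of_ne h, map_zero, Pi.zero_apply]

lemma basisIncl_self (m : I) (c : C.X m) (i : Fin (k m)) :
    basisIncl (I := I) e m c ⟨m, i⟩ = e m c i := by
  change e m (Pi.single (M := fun m => C.X m) (m : ℤ) c (m : ℤ)) i = e m c i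
  rw [Pi.single_eq_same]

lemma basisIncl_basisProj (n : ℤ) (v : (Σ m : I, Fin (k m)) → A) (t : Σ m : I, Fin (k m)) :
    basisIncl e n (basisProj e n v) t = if (t.1 : ℤ) = n then v t else 0 := by
  obtain ⟨m, i⟩ := t
  split_ifs with h
  · subst h
    rw [basisIncl_self, basisProj_apply e m.2, LinearEquiv.apply_symm_apply]
  · rw [basisIncl_of_ne e _ _ h]

lemma basisProj_basisIncl (hI : ∀ n ∉ I, Limits.IsZero (C.X n)) (n m : ℤ) (c : C.X n) :
    basisProj (I := I) e m (basisIncl e n c) = Pi.single (M := fun m => C.X m) n c m := by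
  by_cases h : m ∈ I
  · rw [basisProj_apply e h, LinearEquiv.symm_apply_eq]
    rfl
  · have := ModuleCat.subsingleton_of_isZero (hI m h)
    exact Subsingleton.elim _ _

/-- The totalization of a complex of free modules by the vectors indexed by all basis elements. -/
def basisTotalization (hI : ∀ n ∉ I, Limits.IsZero (C.X n)) :
    Totalization C (V := ModuleCat.of Aᵐᵒᵖ ((Σ m : I, Fin (k m)) → A)) (ModuleCat.ofHom
      (∑ n ∈ I, basisIncl e (n + 1) ∘ₗ (C.d n (n + 1)).hom ∘ₗ basisProj e n)) where
  incl n := ModuleCat.ofHom (basisIncl e n)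
  proj n := ModuleCat.ofHom (basisProj e n)
  degrees := I
  incl_proj n := by
    ext c
    exact (basisProj_basisIncl e hI n n c).trans (Pi.single_eq_same _ _)
  incl_proj_of_ne h := by
    ext c
    exact (basisProj_basisIncl e hI _ _ c).trans (Pi.single_eq_of_ne h.symm _)
  sum_proj_incl := by
    refine ModuleCat.hom_ext (LinearMap.ext fun v => funext fun t => ?_)
    simp only [ModuleCat.hom_sum, ModuleCat.hom_comp, ModuleCat.hom_ofHom, LinearMap.sum_apply,
      LinearMap.comp_apply, Finset.sum_apply, basisIncl_basisProj, ModuleCat.hom_id,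
      LinearMap.id_apply]
    rw [Finset.sum_ite_eq, if_pos t.1.2]
  incl_d n := by
    ext c
    simp only [ModuleCat.hom_comp, ModuleCat.hom_ofHom, LinearMap.sum_apply, LinearMap.comp_apply,
      basisProj_basisIncl e hI]
    by_cases hn : n ∈ I
    · rw [Finset.sum_eq_single_of_mem n hn fun m _ h => by
        rw [Pi.single_eq_of_ne h, map_zero, map_zero], Pi.single_eq_same]
    · have := ModuleCat.subsingleton_of_isZero (hI n hn)
      rw [Subsingleton.elim c 0]
      simp

end Construction

theorem exists_matrixPresentation (C : CochainComplex (ModuleCat.{u} Aᵐᵒᵖ) ℤ)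
    (hC : IsBoundedComplex C)
    (hfree : ∀ n, Module.Finite Aᵐᵒᵖ (C.X n) ∧ Module.Free Aᵐᵒᵖ (C.X n)) :
    ∃ (T : Type) (_ : Fintype T) (_ : DecidableEq T), Nonempty (MatrixPresentation C T) := by
  obtain ⟨I, hI⟩ := hC.exists_finset
  have exists_basis (n : ℤ) : ∃ k : ℕ, Nonempty (C.X n ≃ₗ[Aᵐᵒᵖ] (Fin k → A)) :=
    have := (hfree n).1
    have := (hfree n).2
    exists_linearEquiv_pi (C.X n)
  choose k hk using exists_basis
  let e n := (hk n).some
  obtain ⟨D, hD⟩ := exists_mulOp_eq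
    (∑ n ∈ I, basisIncl (I := I) e (n + 1) ∘ₗ (C.d n (n + 1)).hom ∘ₗ basisProj e n)
  exact ⟨_, inferInstance, inferInstance, ⟨{
    deg := fun t => t.1
    D := D
    tot := (basisTotalization e hI).ofIso (Iso.refl _) (by
      rw [hD, Iso.refl_hom, Category.comp_id, Category.id_comp])
    incl_proj_apply := basisIncl_basisProj e }⟩⟩

lemma mulOp_single_one (D : Matrix T T A) (s t : T) :
    mulOp Aᵐᵒᵖ D (Pi.single t (1 : A)) s = D s t := by
  rw [mulOp_apply, Matrix.Module.smul_apply, Finset.sum_eq_single t]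
  · simp
  · intro t' _ h
    simp [Pi.single_eq_of_ne h]
  · simp

namespace MatrixPresentation

variable {C : CochainComplex (ModuleCat.{u} Aᵐᵒᵖ) ℤ} (P : MatrixPresentation C T)

lemma incl_apply_of_ne {n : ℤ} (c : C.X n) {t : T} (h : P.deg t ≠ n) :
    (P.tot.incl n).hom c t = 0 := by
  rw [← P.tot.proj_incl_apply n c]
  exact (P.incl_proj_apply n _ t).trans (if_neg h)

lemma incl_proj_single (t : T) (a : A) :
    (P.tot.incl (P.deg t)).hom ((P.tot.proj (P.deg t)).hom (Pi.single t a)) = Pi.single t a := by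
  ext s
  rw [P.incl_proj_apply]
  obtain rfl | h := eq_or_ne s t
  · rw [if_pos rfl]
  · rw [Pi.single_eq_of_ne h, ite_self]

include P in
lemma isGradedDifferential : IsGradedDifferential P.deg P.D where
  mul_self := by
    ext s t
    have h : P.D • P.D • (Pi.single t 1 : T → A) = 0 :=
      LinearMap.congr_fun (congrArg ModuleCat.Hom.hom P.tot.d_comp_d) _
    rw [← mulOp_single_one (P.D * P.D), mulOp_apply, mul_smul, h]
    rfl
  deg_eq {s t} := by
    refine not_imp_comm.1 fun h => ?_
    have hd := P.tot.incl_d_apply (P.deg t) ((P.tot.proj (P.deg t)).hom (Pi.single t 1))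
    rw [← mulOp_single_one P.D, ← P.incl_proj_single]
    exact (congrFun hd s).symm.trans (P.incl_apply_of_ne _ h)

end MatrixPresentation

end MatrixPresentation

section BalancedTensor

variable {A : Type u} [Ring A] (N : ModuleCat.{u} A) {M : ModuleCat.{u} Aᵐᵒᵖ}

/-- The pure tensors in `M ⊗_A N`. -/
def balancedMk : M →+ N →+ (tensorFunctor N).obj M :=
  ((Submodule.mkQ (balancedRelations (A := A) M N)).toAddMonoidHom.compHom).comp
    (LinearMap.toAddMonoidHom'.comp (TensorProduct.mk ℤ M N).toAddMonoidHom)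

lemma balancedMk_smul (a : A) (c : M) (x : N) :
    balancedMk N (MulOpposite.op a • c) x = balancedMk N c (a • x) :=
  (Submodule.Quotient.eq (balancedRelations (A := A) M N)).2 (Submodule.subset_span ⟨c, a, x, rfl⟩)

/-- The map out of `M ⊗_A N` given by a balanced biadditive map. -/
def balancedLift {Y : Type*} [AddCommGroup Y] (β : M →+ N →+ Y)
    (hβ : ∀ (a : A) c x, β (MulOpposite.op a • c) x = β c (a • x)) : (tensorFunctor N).obj M →+ Y :=
  (Submodule.liftQ (balancedRelations (A := A) M N)
    (TensorProduct.liftAddHom β fun n c x => by simp).toIntLinearMap (by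
      refine Submodule.span_le.2 ?_
      rintro _ ⟨m, a, s, rfl⟩
      exact LinearMap.mem_ker.2 ((map_sub _ _ _).trans (sub_eq_zero.2 (hβ a m s))))).toAddMonoidHom

lemma balanced_hom_ext {Y : Type*} [AddCommGroup Y] {f g : (tensorFunctor N).obj M →+ Y}
    (h : ∀ c x, f (balancedMk N c x) = g (balancedMk N c x)) : f = g := by
  ext y
  obtain ⟨z, rfl⟩ := Submodule.Quotient.mk_surjective (balancedRelations (A := A) M N) y
  induction z using TensorProduct.induction_on with
  | zero => exact (map_zero f).trans (map_zero g).symm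
  | tmul c x => exact h c x
  | add z w hz hw => exact (map_add f _ _).trans ((congrArg₂ _ hz hw).trans (map_add g _ _).symm)

variable (T : Type) [Fintype T] [DecidableEq T]

/-- The coordinates of an element of `(T → A) ⊗_A N`. -/
def balancedCoord : (tensorFunctor N).obj (ModuleCat.of Aᵐᵒᵖ (T → A)) →+ (T → N) :=
  balancedLift N (AddMonoidHom.mk' (fun v : T → A => AddMonoidHom.pi fun t =>
      DistribSMul.toAddMonoidHom N (v t)) fun v w => by ext x t; exact add_smul _ _ _)
    fun a v x => by ext t; exact mul_smul (v t) a x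

/-- The element of `(T → A) ⊗_A N` with given coordinates. -/
def balancedOfCoord : (T → N) →+ (tensorFunctor N).obj (ModuleCat.of Aᵐᵒᵖ (T → A)) :=
  ∑ t, (balancedMk N (M := ModuleCat.of Aᵐᵒᵖ (T → A)) (Pi.single t (1 : A))).comp
    (Pi.evalAddMonoidHom (fun _ : T => (N : Type u)) t)

variable {N T} in
lemma balancedOfCoord_apply (v : T → N) : balancedOfCoord N T v =
    ∑ t, balancedMk N (M := ModuleCat.of Aᵐᵒᵖ (T → A)) (Pi.single t (1 : A)) (v t) := by
  rw [balancedOfCoord, AddMonoidHom.finsetSum_apply]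
  rfl

lemma balancedOfCoord_comp_balancedCoord :
    (balancedOfCoord N T).comp (balancedCoord N T) = AddMonoidHom.id _ := by
  let V := ModuleCat.of Aᵐᵒᵖ (T → A)
  let b (t : T) : V := Pi.single t (1 : A)
  refine balanced_hom_ext N fun (v : T → A) x => ?_
  calc balancedOfCoord N T (fun t => v t • x)
      = ∑ t, balancedMk N (b t) (v t • x) := balancedOfCoord_apply _
    _ = ∑ t, balancedMk N (MulOpposite.op (v t) • b t) x := by simp only [balancedMk_smul]
    _ = balancedMk N (∑ t, MulOpposite.op (v t) • b t) x := by
      rw [map_sum, AddMonoidHom.finsetSum_apply]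
    _ = balancedMk N (M := V) v x := congrArg (balancedMk N (M := V) · x) (sum_single_op_smul v)

lemma balancedCoord_comp_balancedOfCoord :
    (balancedCoord N T).comp (balancedOfCoord N T) = AddMonoidHom.id _ := by
  refine AddMonoidHom.ext fun v => funext fun s => ?_
  rw [AddMonoidHom.comp_apply, balancedOfCoord_apply, map_sum, Finset.sum_apply]
  change ∑ t, (Pi.single t 1 : T → A) s • v t = v s
  rw [Finset.sum_eq_single s]
  · simp
  · intro t _ h
    simp [Pi.single_eq_of_ne h.symm]
  · simp

/-- The tensor product over `A` of a free right module with a left module. -/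
def balancedPiEquiv : (tensorFunctor N).obj (ModuleCat.of Aᵐᵒᵖ (T → A)) ≃+ (T → N) :=
  (balancedCoord N T).toAddEquiv (balancedOfCoord N T)
    (balancedOfCoord_comp_balancedCoord N T) (balancedCoord_comp_balancedOfCoord N T)

lemma balancedPiEquiv_map (D : Matrix T T A)
    (y : (tensorFunctor N).obj (ModuleCat.of Aᵐᵒᵖ (T → A))) :
    balancedPiEquiv N T ((tensorFunctor N).map (ModuleCat.ofHom (mulOp Aᵐᵒᵖ D)) y) =
      mulOp ℤ D (balancedPiEquiv N T y) := by
  suffices h : (balancedCoord N T).comp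
      ((tensorFunctor N).map (ModuleCat.ofHom (mulOp Aᵐᵒᵖ D))).hom.toAddMonoidHom =
      (mulOp ℤ D).toAddMonoidHom.comp (balancedCoord N T) from DFunLike.congr_fun h y
  refine balanced_hom_ext N fun (v : T → A) x => ?_
  ext s
  change (∑ t, D s t • v t) • x = ∑ t, D s t • v t • x
  simp only [Finset.sum_smul, smul_eq_mul, mul_smul]

end BalancedTensor

section AcyclicTensor

variable {A : Type u} [Ring A] {T : Type} [Fintype T] [DecidableEq T]
  {C : CochainComplex (ModuleCat.{u} Aᵐᵒᵖ) ℤ}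

namespace MatrixPresentation

theorem acyclic_tensorComplex_iff (P : MatrixPresentation C T) {S : Type u} [Ring S] (φ : A →+* S) :
    (tensorComplex φ C).Acyclic ↔ IsExactOver φ P.D := by
  let N := (ModuleCat.restrictScalars φ).obj (ModuleCat.of S S)
  let τ := (P.tot.map (tensorFunctor N)).ofIso
    (V' := ModuleCat.of ℤ (T → N)) (d' := ModuleCat.ofHom (mulOp ℤ P.D))
    (balancedPiEquiv N T).toIntLinearEquiv.toModuleIso
    (ModuleCat.hom_ext (LinearMap.ext (balancedPiEquiv_map N T P.D)))
  exact τ.acyclic_iff.trans (isExactOver_iff (S := S)).symm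

end MatrixPresentation

end AcyclicTensor

section Domination

variable {R : Type u} [Ring R] {C : CochainComplex (ModuleCat.{u} (LaurentPoly₂ R)ᵐᵒᵖ) ℤ}
  {T : Type} [Fintype T] [DecidableEq T]

/-- The underlying complex of right `R`-modules of a complex of right modules over the Laurent
polynomial ring. -/
abbrev baseComplex (C : CochainComplex (ModuleCat.{u} (LaurentPoly₂ R)ᵐᵒᵖ) ℤ) :
    CochainComplex (ModuleCat.{u} Rᵐᵒᵖ) ℤ :=
  ((ModuleCat.restrictScalars
    (RingHom.op (AddMonoidAlgebra.singleZeroRingHom : R →+* LaurentPoly₂ R))).mapHomologicalComplex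
      (ComplexShape.up ℤ)).obj C

/-- The vectors over the Laurent polynomial ring, with the `R`-module structure obtained by
restriction of scalars, are the vectors with their coefficientwise `R`-module structure. -/
def restrictScalarsPiEquiv (R : Type u) [Ring R] (T : Type) :
    (ModuleCat.restrictScalars
      (RingHom.op (AddMonoidAlgebra.singleZeroRingHom : R →+* LaurentPoly₂ R))).obj
        (ModuleCat.of (LaurentPoly₂ R)ᵐᵒᵖ (T → LaurentPoly₂ R)) ≃ₗ[Rᵐᵒᵖ] (T → LaurentPoly₂ R) where
  __ := AddEquiv.refl (T → LaurentPoly₂ R)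
  map_smul' r v := funext fun t => (op_smul_eq_mul_single r ((v : T → LaurentPoly₂ R) t)).symm

namespace MatrixPresentation

variable (P : MatrixPresentation C T)

/-- The direct sum of the components of the underlying complex of `R`-modules. -/
def baseTot : Totalization (baseComplex C) (V := ModuleCat.of Rᵐᵒᵖ (T → LaurentPoly₂ R))
    (ModuleCat.ofHom (mulOp Rᵐᵒᵖ P.D)) :=
  (P.tot.map _).ofIso (restrictScalarsPiEquiv R T).toModuleIso rfl

lemma baseTot_incl_proj_apply (n : ℤ) (v : T → LaurentPoly₂ R) (t : T) :
    (P.baseTot.incl n).hom ((P.baseTot.proj n).hom v) t = if P.deg t = n then v t else 0 :=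
  P.incl_proj_apply n v t

end MatrixPresentation

theorem IsFinitelyDominated.homotopyFinite (P : MatrixPresentation C T)
    (h : IsFinitelyDominated (AddMonoidAlgebra.singleZeroRingHom : R →+* LaurentPoly₂ R) C) :
    HomotopyFinite P.D := by
  obtain ⟨B, -, hB, ⟨e⟩⟩ := h
  obtain ⟨H, hH⟩ := P.baseTot.exists_lift_of_homotopy e.homotopyHomInvId.symm
  have defect_apply (n : ℤ) (c : (baseComplex C).X n) :
      homotopyDefect (mulOp Rᵐᵒᵖ P.D) H.hom (P.baseTot.incl n c) =
        P.baseTot.incl n (e.inv.f n (e.hom.f n c)) :=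
    ConcreteCategory.congr_hom (hH n) c
  have range_fg (n : ℤ) : (LinearMap.range (e.inv.f n ≫ P.baseTot.incl n).hom).FG :=
    have := (hB n).1
    Module.Finite.iff_fg.1 inferInstance
  obtain ⟨A, hA, hle⟩ := exists_le_supportedIn
    (Submodule.fg_biSup P.baseTot.degrees _ fun n _ => range_fg n)
  refine ⟨H.hom, A, hA, fun v => hle ?_⟩
  rw [← P.baseTot.sum_incl_proj_apply v, map_sum]
  refine Submodule.sum_mem_biSup fun n _ => ?_
  rw [defect_apply]
  exact LinearMap.mem_range_self (e.inv.f n ≫ P.baseTot.incl n).hom _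

end Domination

section Truncation

variable {𝒞 : Type*} [Category 𝒞] [Abelian 𝒞]

lemma exists_truncated_nullHomotopy {X : CochainComplex 𝒞 ℤ} {p : X ⟶ X}
    (s : Homotopy (𝟙 X) p) {a : ℤ} (hp : ∀ n < a, p.f n = 0) :
    ∃ q : X ⟶ X, Nonempty (Homotopy q 0) ∧ (∀ n < a, q.f n = 𝟙 (X.X n)) ∧
      q.f a = s.hom a (a - 1) ≫ X.d (a - 1) a ∧ ∀ n, a < n → q.f n = 0 := by
  let truncated (i j : ℤ) : X.X i ⟶ X.X j := if i ≤ a then s.hom i j else 0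
  have q_f (n : ℤ) : (Homotopy.nullHomotopicMap truncated).f n =
      X.d n (n + 1) ≫ truncated (n + 1) n + truncated n (n - 1) ≫ X.d (n - 1) n :=
    Homotopy.nullHomotopicMap_f (by simp) (by simp) truncated
  refine ⟨Homotopy.nullHomotopicMap truncated, ⟨Homotopy.nullHomotopy truncated fun i j hij => ?_⟩,
    fun n hn => ?_, ?_, fun n hn => ?_⟩
  · simp only [truncated, s.zero i j hij, ite_self]
  · have := s.comm n
    rw [hp n hn, add_zero, dNext_eq _ (show (ComplexShape.up ℤ).Rel n (n + 1) by simp),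
      prevD_eq _ (show (ComplexShape.up ℤ).Rel (n - 1) n by simp)] at this
    simp only [q_f, truncated, if_pos hn.le, if_pos (show n + 1 ≤ a from hn), ← this,
      HomologicalComplex.id_f]
  · simp only [q_f, truncated, le_refl, if_true, if_neg (show ¬ a + 1 ≤ a by omega),
      Limits.comp_zero, zero_add]
  · simp only [q_f, truncated, if_neg hn.not_ge, if_neg (show ¬ n + 1 ≤ a by omega),
      Limits.comp_zero, Limits.zero_comp, add_zero]

lemma exists_idempotent_of_homotopy_id {X : CochainComplex 𝒞 ℤ} {p : X ⟶ X}
    (s : Homotopy (𝟙 X) p) {a : ℤ} (hp : ∀ n < a, p.f n = 0) :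
    ∃ e : X ⟶ X, e ≫ e = e ∧ (∀ n < a, e.f n = 0) ∧ Nonempty (Homotopy e (𝟙 X)) := by
  obtain ⟨q, ⟨hq⟩, q_f_of_lt, q_f_self, q_f_of_gt⟩ := exists_truncated_nullHomotopy s hp
  have q_idem : q ≫ q = q := by
    ext n
    rw [HomologicalComplex.comp_f]
    obtain hn | rfl | hn := lt_trichotomy n a
    · rw [q_f_of_lt n hn, Category.id_comp]
    · calc q.f n ≫ q.f n = s.hom n (n - 1) ≫ X.d (n - 1) n ≫ q.f n := by
            rw [← Category.assoc, ← q_f_self]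
        _ = q.f n := by
            rw [← q.comm, q_f_of_lt (n - 1) (by omega), Category.id_comp, q_f_self]
    · rw [q_f_of_gt n hn, Limits.comp_zero]
  refine ⟨𝟙 X - q, ?_, fun n hn => ?_, ⟨(Homotopy.equivSubZero.symm ?_).symm⟩⟩
  · rw [Preadditive.sub_comp, Category.id_comp, Preadditive.comp_sub, Category.comp_id, q_idem,
      sub_self, sub_zero]
  · rw [HomologicalComplex.sub_f_apply, HomologicalComplex.id_f, q_f_of_lt n hn, sub_self]
  · exact (Homotopy.ofEq (sub_sub_cancel _ _)).trans hq

theorem exists_homotopyEquiv_isStrictlyGE {K X : CochainComplex 𝒞 ℤ} (e : HomotopyEquiv K X)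
    (a : ℤ) [K.IsStrictlyGE a] :
    ∃ B : CochainComplex 𝒞 ℤ, B.IsStrictlyGE a ∧ Nonempty (HomotopyEquiv X B) ∧
      Nonempty (Retract B X) := by
  obtain ⟨p, hp, hpa, ⟨s⟩⟩ := exists_idempotent_of_homotopy_id e.homotopyInvHomId.symm (a := a)
    fun n hn => by
      rw [HomologicalComplex.comp_f, (K.isZero_of_isStrictlyGE a n hn).eq_zero_of_tgt (e.inv.f n),
        Limits.zero_comp]
  obtain ⟨B, i, r, hir, hri⟩ := IsIdempotentComplete.idempotents_split X p hp
  refine ⟨B, (B.isStrictlyGE_iff a).2 fun n hn => ?_,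
    ⟨r, i, (Homotopy.ofEq hri).trans s, Homotopy.ofEq hir⟩, ⟨i, r, hir⟩⟩
  have h : i ≫ p ≫ r = 𝟙 B := by
    rw [← hri, Category.assoc, hir, Category.comp_id, hir]
  rw [Limits.IsZero.iff_id_eq_zero, ← HomologicalComplex.id_f, ← h, HomologicalComplex.comp_f,
    HomologicalComplex.comp_f, hpa n hn, Limits.zero_comp, Limits.comp_zero]

end Truncation

section HomotopyOfSucc

variable {𝒞 : Type*} [Category 𝒞] [Preadditive 𝒞]

/-- A homotopy between maps of cochain complexes, from maps indexed by their target degree. -/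
def homotopyOfSucc {X Y : CochainComplex 𝒞 ℤ} {f g : X ⟶ Y} (s : ∀ n, X.X (n + 1) ⟶ Y.X n)
    (hs : ∀ n, f.f (n + 1) =
      X.d (n + 1) (n + 1 + 1) ≫ s (n + 1) + s n ≫ Y.d n (n + 1) + g.f (n + 1)) :
    Homotopy f g where
  hom i j := if h : j + 1 = i then eqToHom (by rw [h]) ≫ s j else 0
  zero i j hij := dif_neg hij
  comm i := by
    obtain ⟨n, rfl⟩ : ∃ n, i = n + 1 := ⟨i - 1, by omega⟩
    rw [dNext_eq _ (show (ComplexShape.up ℤ).Rel (n + 1) (n + 1 + 1) by simp),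
      prevD_eq _ (show (ComplexShape.up ℤ).Rel n (n + 1) by simp), hs, dif_pos rfl, dif_pos rfl,
      eqToHom_refl, eqToHom_refl, Category.id_comp, Category.id_comp]

end HomotopyOfSucc

section GradedComplex

variable {A : Type*} [Ring A] {V W : Type u} [AddCommGroup V] [Module A V] [AddCommGroup W]
  [Module A W]

/-- A differential on a module that raises by one the degree in a family of submodules. -/
structure RaisesDegree (d : Module.End A V) (M : ℤ → Submodule A V) : Prop where
  mul_self : d * d = 0
  map_mem {n : ℤ} {v : V} (hv : v ∈ M n) : d v ∈ M (n + 1)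

namespace RaisesDegree

variable {d : Module.End A V} {M : ℤ → Submodule A V} {d' : Module.End A W}
  {M' : ℤ → Submodule A W}

lemma apply_apply (hd : RaisesDegree d M) (v : V) : d (d v) = 0 :=
  LinearMap.congr_fun hd.mul_self v

/-- The cochain complex formed by the submodules. -/
def complex (hd : RaisesDegree d M) : CochainComplex (ModuleCat.{u} A) ℤ :=
  CochainComplex.of (fun n => ModuleCat.of A (M n))
    (fun _ => ModuleCat.ofHom (d.restrict fun _ => hd.map_mem))
    fun _ => ModuleCat.hom_ext (LinearMap.ext fun v => Subtype.ext (hd.apply_apply v.1))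

lemma complex_d (hd : RaisesDegree d M) (n : ℤ) :
    hd.complex.d n (n + 1) = ModuleCat.ofHom (d.restrict fun _ => hd.map_mem) :=
  CochainComplex.of_d (fun n => ModuleCat.of A (M n))
    (fun _ => ModuleCat.ofHom (d.restrict fun _ => hd.map_mem)) n

/-- The map of cochain complexes induced by a linear map that preserves degrees. -/
def mapComplex (hd : RaisesDegree d M) (hd' : RaisesDegree d' M') (f : V →ₗ[A] W)
    (hf : ∀ n, ∀ v ∈ M n, f v ∈ M' n) (hcomm : ∀ v, d' (f v) = f (d v)) :
    hd.complex ⟶ hd'.complex where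
  f n := ModuleCat.ofHom (f.restrict (hf n))
  comm' := by
    rintro n _ rfl
    rw [complex_d, complex_d]
    exact ModuleCat.hom_ext (LinearMap.ext fun v => Subtype.ext (hcomm v.1))

/-- The homotopy to the identity induced by a linear map that lowers degrees by one. -/
def homotopy (hd : RaisesDegree d M) {f : hd.complex ⟶ hd.complex} (s : Module.End A V)
    (hs : ∀ n, ∀ v ∈ M (n + 1), s v ∈ M n)
    (hf : ∀ n (v : M n), (f.f n v : M n).1 = homotopyDefect d s v.1) : Homotopy f (𝟙 _) :=
  .symm <| homotopyOfSucc (fun n => ModuleCat.ofHom (s.restrict (hs n))) fun n => by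
    rw [complex_d, complex_d]
    refine ModuleCat.hom_ext (LinearMap.ext fun v => Subtype.ext ?_)
    have h (x : V) : x = s (d x) + d (s x) + homotopyDefect d s x := by
      rw [homotopyDefect_apply]
      abel
    exact (h v.1).trans (congrArg _ (hf (n + 1) v).symm)

/-- The homotopy equivalence induced by linear maps that are inverse up to homotopy. -/
def homotopyEquiv (hd : RaisesDegree d M) (hd' : RaisesDegree d' M') (f : V →ₗ[A] W)
    (g : W →ₗ[A] V) (s : Module.End A V) (s' : Module.End A W)
    (hf : ∀ n, ∀ v ∈ M n, f v ∈ M' n) (hg : ∀ n, ∀ w ∈ M' n, g w ∈ M n)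
    (hs : ∀ n, ∀ v ∈ M (n + 1), s v ∈ M n) (hs' : ∀ n, ∀ w ∈ M' (n + 1), s' w ∈ M' n)
    (hfd : ∀ v, d' (f v) = f (d v)) (hgd : ∀ w, d (g w) = g (d' w))
    (hgf : ∀ v, g (f v) = homotopyDefect d s v) (hfg : ∀ w, f (g w) = homotopyDefect d' s' w) :
    HomotopyEquiv hd.complex hd'.complex where
  hom := mapComplex hd hd' f hf hfd
  inv := mapComplex hd' hd g hg hgd
  homotopyHomInvId := hd.homotopy s hs fun _ v => hgf v.1
  homotopyInvHomId := hd'.homotopy s' hs' fun _ w => hfg w.1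

end RaisesDegree

end GradedComplex

section Telescope

variable {A V : Type*} [Ring A] [AddCommGroup V] [Module A V] (d h : Module.End A V)

lemma mul_homotopyDefect {d : Module.End A V} (hd : d * d = 0) (h : Module.End A V) :
    d * homotopyDefect d h = homotopyDefect d h * d := by
  simp only [homotopyDefect, mul_sub, sub_mul, mul_one, one_mul, mul_assoc, hd, mul_zero]
  rw [← mul_assoc d d, hd, zero_mul]
  abel

variable (A V) in
/-- Multiplication by the variable `u` on the module `ℕ →₀ V` of polynomials in `u` with
coefficients in `V`. -/
def polyShift : Module.End A (ℕ →₀ V) := Finsupp.lmapDomain V A Nat.succ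

lemma polyShift_single (k : ℕ) (y : V) :
    polyShift A V (.single k y) = .single (k + 1) y :=
  Finsupp.mapDomain_single

@[elab_as_elim]
lemma poly_induction {Q : (ℕ →₀ V) → Prop} (hadd : ∀ v w, Q v → Q w → Q (v + w))
    (hconst : ∀ y, Q (.single 0 y)) (hshift : ∀ w, Q w → Q (polyShift A V w)) (w : ℕ →₀ V) :
    Q w := by
  refine Finsupp.induction_linear w ?_ hadd fun k y => ?_
  · exact Finsupp.single_zero (M := V) 0 ▸ hconst 0
  · induction k with
    | zero => exact hconst y
    | succ k ih => exact polyShift_single (A := A) k y ▸ hshift _ ih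

/-- Evaluation of polynomials at `u = h`. -/
def polyEval : (ℕ →₀ V) →ₗ[A] V := Finsupp.lsum ℕ fun k => h ^ k

lemma polyEval_single (k : ℕ) (y : V) : polyEval h (.single k y) = (h ^ k) y :=
  Finsupp.lsum_single ..

lemma polyEval_const (y : V) : polyEval h (.single 0 y) = y := by
  rw [polyEval_single, pow_zero, Module.End.one_apply]

lemma polyEval_shift (w : ℕ →₀ V) : polyEval h (polyShift A V w) = h (polyEval h w) := by
  induction w using Finsupp.induction_linear with
  | zero => simp only [map_zero]
  | add v w hv hw => simp only [map_add, hv, hw]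
  | single k y =>
    rw [polyShift_single, polyEval_single, polyEval_single, pow_succ', Module.End.mul_apply]

/-- The differential of the polynomials on the monomials of degree `k`; the recursion is the one
that gives `polyDiff_shift`. -/
def monomialDiff : ℕ → V →ₗ[A] (ℕ →₀ V)
  | 0 => Finsupp.lsingle 0 ∘ₗ d
  | k + 1 => Finsupp.lsingle k - Finsupp.lsingle 0 ∘ₗ homotopyDefect d h ∘ₗ h ^ k
      - polyShift A V ∘ₗ monomialDiff k

/-- The differential on polynomials that extends `d` and for which multiplication by `u` is a
homotopy from the identity to the map that sends a polynomial `w` to the homotopy defect of its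
value `w(h)`. -/
def polyDiff : Module.End A (ℕ →₀ V) := Finsupp.lsum ℕ (monomialDiff d h)

lemma polyDiff_const (y : V) : polyDiff d h (.single 0 y) = .single 0 (d y) :=
  Finsupp.lsum_single ..

lemma polyDiff_shift (w : ℕ →₀ V) : polyDiff d h (polyShift A V w) =
    w - .single 0 (homotopyDefect d h (polyEval h w)) - polyShift A V (polyDiff d h w) := by
  induction w using Finsupp.induction_linear with
  | zero => simp only [map_zero, Finsupp.single_zero, sub_zero]
  | add v w hv hw =>
    simp only [map_add, hv, hw, Finsupp.single_add]
    abel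
  | single k y =>
    rw [polyShift_single, polyEval_single]
    exact (Finsupp.lsum_single ..).trans
      (congrArg (_ - polyShift A V ·) (Finsupp.lsum_single ..).symm)

lemma polyEval_diff (w : ℕ →₀ V) : polyEval h (polyDiff d h w) = d (polyEval h w) := by
  refine poly_induction (A := A) (fun v w hv hw => ?_) (fun y => ?_) (fun w hw => ?_) w
  · simp only [map_add, hv, hw]
  · rw [polyDiff_const, polyEval_const, polyEval_const]
  · rw [polyDiff_shift, map_sub, map_sub, polyEval_const, polyEval_shift, polyEval_shift, hw,
      homotopyDefect_apply]
    abel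

lemma polyDiff_mul_self {d : Module.End A V} (hd : d * d = 0) (h : Module.End A V) :
    polyDiff d h * polyDiff d h = 0 := by
  refine LinearMap.ext fun w => ?_
  rw [Module.End.mul_apply, LinearMap.zero_apply]
  refine poly_induction (A := A) (fun v w hv hw => ?_) (fun y => ?_) (fun w hw => ?_) w
  · rw [map_add, map_add, hv, hw, add_zero]
  · rw [polyDiff_const, polyDiff_const, ← Module.End.mul_apply, hd, LinearMap.zero_apply,
      Finsupp.single_zero]
  · have hcomm := LinearMap.congr_fun (mul_homotopyDefect hd h) (polyEval h w)
    rw [Module.End.mul_apply, Module.End.mul_apply] at hcomm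
    rw [polyDiff_shift, map_sub, map_sub, polyDiff_const, polyDiff_shift, hw, polyEval_diff,
      hcomm, map_zero]
    abel

end Telescope

section GradedPolynomials

variable {A : Type*} {V : Type u} [Ring A] [AddCommGroup V] [Module A V]
  {F G : ℤ → Submodule A V} {n : ℤ} {w : ℕ →₀ V}

/-- The polynomials of degree `n` with coefficients in a graded submodule, where the variable has
degree `-1`. -/
def gradedPoly (F : ℤ → Submodule A V) (n : ℤ) : Submodule A (ℕ →₀ V) :=
  ⨅ k : ℕ, (F (n + k)).comap (Finsupp.lapply k)

lemma mem_gradedPoly : w ∈ gradedPoly F n ↔ ∀ k : ℕ, w k ∈ F (n + k) := by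
  simp only [gradedPoly, Submodule.mem_iInf, Submodule.mem_comap, Finsupp.lapply_apply]

lemma single_mem_gradedPoly {k : ℕ} {y : V} (hy : y ∈ F (n + k)) :
    Finsupp.single k y ∈ gradedPoly F n := by
  refine mem_gradedPoly.2 fun j => ?_
  obtain rfl | hj := eq_or_ne j k
  · rwa [Finsupp.single_eq_same]
  · rw [Finsupp.single_eq_of_ne hj]
    exact zero_mem _

lemma const_mem_gradedPoly {y : V} (hy : y ∈ F n) : Finsupp.single 0 y ∈ gradedPoly F n :=
  single_mem_gradedPoly (by rwa [Nat.cast_zero, add_zero])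

lemma map_mem_of_single {W : Type*} [AddCommGroup W] [Module A W] (f : (ℕ →₀ V) →ₗ[A] W)
    (N : Submodule A W) (hf : ∀ k : ℕ, ∀ y ∈ F (n + k), f (.single k y) ∈ N)
    (hw : w ∈ gradedPoly F n) : f w ∈ N := by
  rw [← Finsupp.sum_single w, Finsupp.sum, map_sum]
  exact Submodule.sum_mem _ fun k _ => hf k _ (mem_gradedPoly.1 hw k)

lemma polyShift_mem (hw : w ∈ gradedPoly F (n + 1)) : polyShift A V w ∈ gradedPoly F n := by
  refine map_mem_of_single _ _ (fun k y hy => ?_) hw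
  rw [polyShift_single]
  exact single_mem_gradedPoly (by rwa [Nat.cast_add, Nat.cast_one, add_comm (k : ℤ), ← add_assoc])

lemma pow_mem_of_lowers {h : Module.End A V} (hh : ∀ n, ∀ v ∈ G (n + 1), h v ∈ G n) (k : ℕ)
    {y : V} (hy : y ∈ G (n + k)) : (h ^ k) y ∈ G n := by
  induction k generalizing n with
  | zero => rwa [pow_zero, Module.End.one_apply, ← add_zero n]
  | succ k ih =>
    rw [pow_succ', Module.End.mul_apply]
    refine hh n _ (ih ?_)
    rwa [Nat.cast_add, Nat.cast_one, add_comm (k : ℤ), ← add_assoc] at hy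

variable {d h : Module.End A V} (hh : ∀ n, ∀ v ∈ G (n + 1), h v ∈ G n) (hFG : ∀ n, F n ≤ G n)
include hh hFG

lemma polyEval_mem (hw : w ∈ gradedPoly F n) : polyEval h w ∈ G n :=
  map_mem_of_single _ _ (fun k y hy => by
    rw [polyEval_single]
    exact pow_mem_of_lowers hh k (hFG _ hy)) hw

lemma polyDiff_mem (hF : RaisesDegree d F) (he : ∀ n, ∀ v ∈ G n, homotopyDefect d h v ∈ F n)
    (hw : w ∈ gradedPoly F n) : polyDiff d h w ∈ gradedPoly F (n + 1) := by
  refine map_mem_of_single _ _ (fun k y hy => ?_) hw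
  clear hw
  induction k generalizing n with
  | zero =>
    rw [polyDiff_const]
    exact const_mem_gradedPoly (hF.map_mem (by rwa [Nat.cast_zero, add_zero] at hy))
  | succ k ih =>
    rw [Nat.cast_add, Nat.cast_one, add_comm (k : ℤ), ← add_assoc] at hy
    have hy' := single_mem_gradedPoly hy
    rw [← polyShift_single (A := A), polyDiff_shift]
    exact sub_mem (sub_mem hy' (const_mem_gradedPoly (he _ _ (polyEval_mem hh hFG hy'))))
      (polyShift_mem (ih hy))

lemma raisesDegree_polyDiff (hF : RaisesDegree d F)
    (he : ∀ n, ∀ v ∈ G n, homotopyDefect d h v ∈ F n) :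
    RaisesDegree (polyDiff d h) (gradedPoly F) where
  mul_self := polyDiff_mul_self hF.mul_self h
  map_mem := polyDiff_mem hh hFG hF he

/-- If `h` is a homotopy from the identity to a map with values in a graded submodule `F`, then
the complex is homotopy equivalent to that of the polynomials with coefficients in `F`. -/
def homotopyEquivPoly (hG : RaisesDegree d G) (hF : RaisesDegree d F)
    (he : ∀ n, ∀ v ∈ G n, homotopyDefect d h v ∈ F n) :
    HomotopyEquiv hG.complex (raisesDegree_polyDiff hh hFG hF he).complex :=
  hG.homotopyEquiv _ (Finsupp.lsingle 0 ∘ₗ homotopyDefect d h) (polyEval h) h (polyShift A V)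
    (fun n v hv => const_mem_gradedPoly (he n v hv)) (fun _ _ => polyEval_mem hh hFG)
    hh (fun _ _ => polyShift_mem)
    (fun v => (polyDiff_const d h _).trans
      (congrArg _ (LinearMap.congr_fun (mul_homotopyDefect hG.mul_self h) v)))
    (fun w => (polyEval_diff d h w).symm) (fun v => polyEval_const h _)
    fun w => by
      rw [homotopyDefect_apply, polyDiff_shift, sub_sub, sub_add_cancel, sub_sub_cancel]
      rfl

end GradedPolynomials

section FiniteModel

variable {A V : Type u} [Ring A] [AddCommGroup V] [Module A V]
  {F : ℤ → Submodule A V} {b : ℤ}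

lemma eq_zero_of_mem_gradedPoly (hb : ∀ n, b < n → F n = ⊥) {n : ℤ} {w : ℕ →₀ V}
    (hw : w ∈ gradedPoly F n) {k : ℕ} (hk : b < n + k) : w k = 0 :=
  (Submodule.mem_bot A).1 (hb _ hk ▸ mem_gradedPoly.1 hw k)

lemma gradedPoly_eq_bot (hb : ∀ n, b < n → F n = ⊥) {n : ℤ} (hn : b < n) :
    gradedPoly F n = ⊥ :=
  eq_bot_iff.2 fun _ hw => (Submodule.mem_bot A).2 <|
    Finsupp.ext fun _ => eq_zero_of_mem_gradedPoly hb hw (by omega)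

/-- The coefficients of the powers of the variable below the `N`-th. -/
def lowCoeffs (F : ℤ → Submodule A V) (n : ℤ) (N : ℕ) :
    gradedPoly F n →ₗ[A] ∀ k : Fin N, F (n + (k : ℕ)) :=
  LinearMap.pi fun k => (Finsupp.lapply (k : ℕ)).restrict fun _ hw => mem_gradedPoly.1 hw k

lemma lowCoeffs_bijective (hb : ∀ n, b < n → F n = ⊥) {n : ℤ} {N : ℕ} (hN : b < n + N) :
    Function.Bijective (lowCoeffs F n N) := by
  refine ⟨fun v w hvw => Subtype.ext <| Finsupp.ext fun k => ?_, fun x => ?_⟩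
  · by_cases hk : k < N
    · exact congrArg Subtype.val (congrFun hvw ⟨k, hk⟩)
    · rw [eq_zero_of_mem_gradedPoly hb v.2 (by omega), eq_zero_of_mem_gradedPoly hb w.2 (by omega)]
  · refine ⟨⟨∑ k : Fin N, .single (k : ℕ) (x k).1,
      Submodule.sum_mem _ fun k _ => single_mem_gradedPoly (x k).2⟩,
      funext fun j => Subtype.ext ?_⟩
    change (∑ k : Fin N, Finsupp.single (k : ℕ) (x k).1) (j : ℕ) = (x j).1
    rw [Finsupp.finsetSum_apply, Finset.sum_eq_single_of_mem j (Finset.mem_univ j),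
      Finsupp.single_eq_same]
    exact fun k _ hk => Finsupp.single_eq_of_ne fun h => hk (Fin.ext h.symm)

/-- If the coefficients vanish in degrees above `b`, a polynomial of degree `n` is a finite
family of coefficients. -/
def gradedPolyEquiv (hb : ∀ n, b < n → F n = ⊥) (n : ℤ) :
    gradedPoly F n ≃ₗ[A] ∀ k : Fin (b - n + 1).toNat, F (n + (k : ℕ)) :=
  LinearEquiv.ofBijective (lowCoeffs F n _) (lowCoeffs_bijective hb (by omega))

lemma finite_gradedPoly (hb : ∀ n, b < n → F n = ⊥) [∀ n, Module.Finite A (F n)] (n : ℤ) :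
    Module.Finite A (gradedPoly F n) :=
  Module.Finite.equiv (gradedPolyEquiv hb n).symm

lemma projective_gradedPoly (hb : ∀ n, b < n → F n = ⊥) [∀ n, Module.Projective A (F n)]
    (n : ℤ) : Module.Projective A (gradedPoly F n) :=
  Module.Projective.of_equiv (DFinsupp.linearEquivFunOnFintype.trans (gradedPolyEquiv hb n).symm)

namespace Totalization

variable {K : CochainComplex (ModuleCat.{u} A) ℤ} {d : Module.End A V}
  (τ : Totalization K (V := ModuleCat.of A V) (ModuleCat.ofHom d))

lemma raisesDegree :
    RaisesDegree d fun n => LinearMap.range (τ.incl n).hom where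
  mul_self := congrArg ModuleCat.Hom.hom τ.d_comp_d
  map_mem := by
    rintro n _ ⟨x, rfl⟩
    exact ⟨K.d n (n + 1) x, τ.incl_d_apply n x⟩

include τ in
lemma isBoundedComplex : IsBoundedComplex K := by
  obtain ⟨a, ha⟩ := τ.degrees.bddBelow
  obtain ⟨b, hb⟩ := τ.degrees.bddAbove
  exact ⟨a, b,
    (K.isStrictlyGE_iff a).2 fun n hn => τ.isZero_of_notMem_degrees fun h => hn.not_ge (ha h),
    (K.isStrictlyLE_iff b).2 fun n hn => τ.isZero_of_notMem_degrees fun h => hn.not_ge (hb h)⟩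

lemma range_incl_eq_bot {n : ℤ} (h : Limits.IsZero (K.X n)) :
    LinearMap.range (τ.incl n).hom = ⊥ := by
  rw [h.eq_zero_of_src (τ.incl n), ModuleCat.hom_zero, LinearMap.range_zero]

/-- A complex is isomorphic to that of its components in a totalization. -/
def isoComplex : K ≅ τ.raisesDegree.complex :=
  HomologicalComplex.Hom.isoOfComponents
    (fun n => (LinearEquiv.ofInjective (τ.incl n).hom (τ.incl_injective n)).toModuleIso) <| by
    rintro n _ rfl
    rw [RaisesDegree.complex_d]
    exact ModuleCat.hom_ext (LinearMap.ext fun x => Subtype.ext (τ.incl_d_apply n x).symm)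

end Totalization

lemma finite_of_retract {M N : ModuleCat.{u} A} (r : Retract M N) [Module.Finite A N] :
    Module.Finite A M :=
  Module.Finite.of_surjective r.r.hom fun x => ⟨r.i x, ConcreteCategory.congr_hom r.retract x⟩

lemma projective_of_retract {M N : ModuleCat.{u} A} (r : Retract M N) [Module.Projective A N] :
    Module.Projective A M :=
  Module.Projective.of_split r.i.hom r.r.hom (congrArg ModuleCat.Hom.hom r.retract)

theorem Totalization.exists_finite_projective_model {K : CochainComplex (ModuleCat.{u} A) ℤ}
    {d h : Module.End A V} (τ : Totalization K (V := ModuleCat.of A V) (ModuleCat.ofHom d))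
    (hh : ∀ n, ∀ v ∈ LinearMap.range (τ.incl (n + 1)).hom, h v ∈ LinearMap.range (τ.incl n).hom)
    (hF : RaisesDegree d F) (hfin : ∀ n, Module.Finite A (F n))
    (hproj : ∀ n, Module.Projective A (F n)) (hle : ∀ n, F n ≤ LinearMap.range (τ.incl n).hom)
    (he : ∀ n, ∀ v ∈ LinearMap.range (τ.incl n).hom, homotopyDefect d h v ∈ F n) :
    ∃ B : CochainComplex (ModuleCat.{u} A) ℤ, IsBoundedComplex B ∧
      (∀ n, Module.Finite A (B.X n) ∧ Module.Projective A (B.X n)) ∧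
      Nonempty (HomotopyEquiv K B) := by
  obtain ⟨a, b, _, _⟩ := τ.isBoundedComplex
  have hb (n : ℤ) (hn : b < n) : F n = ⊥ :=
    eq_bot_iff.2 ((hle n).trans (τ.range_incl_eq_bot (K.isZero_of_isStrictlyLE b n hn)).le)
  let polys := (raisesDegree_polyDiff hh hle hF he).complex
  let e : HomotopyEquiv K polys :=
    (HomotopyEquiv.ofIso τ.isoComplex).trans (homotopyEquivPoly hh hle τ.raisesDegree hF he)
  obtain ⟨B, hBa, ⟨e'⟩, ⟨r⟩⟩ := exists_homotopyEquiv_isStrictlyGE e a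
  let retract (n : ℤ) : Retract (B.X n) (polys.X n) := r.map (HomologicalComplex.eval _ _ n)
  have finite_polys (n : ℤ) : Module.Finite A (polys.X n) := finite_gradedPoly hb n
  have projective_polys (n : ℤ) : Module.Projective A (polys.X n) :=
    projective_gradedPoly hb n
  refine ⟨B, ⟨a, b, hBa, (B.isStrictlyLE_iff b).2 fun n hn => ?_⟩,
    fun n => ⟨finite_of_retract (retract n), projective_of_retract (retract n)⟩, ⟨e.trans e'⟩⟩
  have : Subsingleton (polys.X n) := Submodule.subsingleton_iff_eq_bot.2 (gradedPoly_eq_bot hb hn)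
  exact Limits.IsZero.of_mono (retract n).i (ModuleCat.isZero_of_subsingleton (polys.X n))

end FiniteModel

section Realisation

variable {R : Type*} {G T : Type*} [Ring R]

lemma exists_seq_map_supportedIn_le [Finite T] (f : Module.End Rᵐᵒᵖ (T → AddMonoidAlgebra R G))
    {A : Set (T × G)} (hA : A.Finite) :
    ∃ B : ℕ → Set (T × G), (∀ k, (B k).Finite) ∧ (∀ k, A ⊆ B k) ∧
      ∀ k, ∀ v ∈ supportedIn R (B k), f v ∈ supportedIn R (B (k + 1)) := by
  have step (B : {B : Set (T × G) // B.Finite ∧ A ⊆ B}) :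
      ∃ B' : {B : Set (T × G) // B.Finite ∧ A ⊆ B},
        ∀ v ∈ supportedIn R B.1, f v ∈ supportedIn R B'.1 := by
    obtain ⟨B', hB', hf⟩ := exists_map_supportedIn_le f B.2.1
    exact ⟨⟨A ∪ B', hA.union hB', Set.subset_union_left⟩,
      fun v hv => supportedIn_mono Set.subset_union_right (hf v hv)⟩
  choose next hnext using step
  refine ⟨fun k => (next^[k] ⟨A, hA, subset_rfl⟩).1, fun k => (next^[k] _).2.1,
    fun k => (next^[k] _).2.2, fun k v hv => ?_⟩
  simp only [Function.iterate_succ_apply']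
  exact hnext _ v hv

end Realisation

section FiniteDomination

variable {R : Type u} [Ring R] {C : CochainComplex (ModuleCat.{u} (LaurentPoly₂ R)ᵐᵒᵖ) ℤ}
  {T : Type} [Fintype T] [DecidableEq T] (P : MatrixPresentation C T)

lemma MatrixPresentation.range_baseTot_incl (n : ℤ) :
    LinearMap.range (P.baseTot.incl n).hom = supportedIn R {p | P.deg p.1 = n} := by
  ext v
  constructor
  · rintro ⟨x, rfl⟩ t g h
    by_contra hn
    refine h ?_
    rw [← P.baseTot.proj_incl_apply n x]
    exact congrArg (fun l => l.coeff g) ((P.baseTot_incl_proj_apply n _ t).trans (if_neg hn))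
  · intro hv
    refine ⟨P.baseTot.proj n v, funext fun t => ?_⟩
    rw [P.baseTot_incl_proj_apply]
    split_ifs with h
    · rfl
    · ext g
      exact (not_imp_comm.1 (hv t g) h).symm

lemma MatrixPresentation.baseTot_incl_proj_mem_supportedIn {A : Set (T × (ℤ × ℤ))} (n : ℤ)
    {v : T → LaurentPoly₂ R} (hv : v ∈ supportedIn R A) :
    (P.baseTot.incl n).hom ((P.baseTot.proj n).hom v) ∈ supportedIn R A := by
  intro t g h
  rw [P.baseTot_incl_proj_apply] at h
  split_ifs at h
  exacts [hv t g h, absurd rfl h]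

lemma MatrixPresentation.raisesDegree_inf_supportedIn {a : ℤ} [(baseComplex C).IsStrictlyGE a]
    {B : ℕ → Set (T × (ℤ × ℤ))}
    (hB : ∀ k, ∀ v ∈ supportedIn R (B k), mulOp Rᵐᵒᵖ P.D v ∈ supportedIn R (B (k + 1))) :
    RaisesDegree (mulOp Rᵐᵒᵖ P.D) fun n =>
      LinearMap.range (P.baseTot.incl n).hom ⊓ supportedIn R (B (n - a).toNat) where
  mul_self := P.baseTot.raisesDegree.mul_self
  map_mem {n v} hv := by
    refine ⟨P.baseTot.raisesDegree.map_mem hv.1, ?_⟩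
    rcases lt_or_ge n a with hn | hn
    · have hv₀ : v = 0 := by
        rw [← Submodule.mem_bot Rᵐᵒᵖ, ← P.baseTot.range_incl_eq_bot
          ((baseComplex C).isZero_of_isStrictlyGE a n hn)]
        exact hv.1
      rw [hv₀, map_zero]
      exact zero_mem _
    · rw [show (n + 1 - a).toNat = (n - a).toNat + 1 by omega]
      exact hB _ v hv.2

theorem HomotopyFinite.isFinitelyDominated (h : HomotopyFinite P.D) :
    IsFinitelyDominated (AddMonoidAlgebra.singleZeroRingHom : R →+* LaurentPoly₂ R) C := by
  obtain ⟨H, A, hA, hH⟩ := h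
  obtain ⟨s, hlower, hdefect⟩ := P.baseTot.exists_lowering (ModuleCat.ofHom H)
  obtain ⟨B, hB, hAB, hDB⟩ := exists_seq_map_supportedIn_le (mulOp Rᵐᵒᵖ P.D) hA
  obtain ⟨a, -, _, -⟩ := P.baseTot.isBoundedComplex
  have supports (n : ℤ) : LinearMap.range (P.baseTot.incl n).hom ⊓
      supportedIn R (B (n - a).toNat) = supportedIn R ({p | P.deg p.1 = n} ∩ B (n - a).toNat) := by
    rw [P.range_baseTot_incl, ← supportedIn_inter]
  have finite_support (n : ℤ) : ({p | P.deg p.1 = n} ∩ B (n - a).toNat).Finite :=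
    (hB _).inter_of_right _
  refine P.baseTot.exists_finite_projective_model (h := s.hom) ?_
    (P.raisesDegree_inf_supportedIn hDB)
    (fun n => supports n ▸ finite_supportedIn (finite_support n))
    (fun n => supports n ▸ projective_supportedIn (finite_support n)) (fun _ => inf_le_left) ?_
  · rintro n _ ⟨x, rfl⟩
    obtain ⟨ψ, hψ⟩ := hlower n
    exact ⟨ψ x, (ConcreteCategory.congr_hom hψ x).symm⟩
  · rintro n _ ⟨x, rfl⟩
    have defect_eq : homotopyDefect (mulOp Rᵐᵒᵖ P.D) s.hom ((P.baseTot.incl n).hom x) =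
        (P.baseTot.incl n).hom ((P.baseTot.proj n).hom
          (homotopyDefect (mulOp Rᵐᵒᵖ P.D) H ((P.baseTot.incl n).hom x))) :=
      ConcreteCategory.congr_hom (hdefect n) x
    rw [defect_eq]
    exact ⟨LinearMap.mem_range_self _ _,
      P.baseTot_incl_proj_mem_supportedIn n (supportedIn_mono (hAB _) (hH _))⟩

end FiniteDomination

end

theorem mainTheorem1 {R : Type u} [Ring R]
    (C : CochainComplex (ModuleCat.{u} (LaurentPoly₂ R)ᵐᵒᵖ) ℤ)
    (hbdd : IsBoundedComplex C)
    (hfree : ∀ n, Module.Finite (LaurentPoly₂ R)ᵐᵒᵖ (C.X n) ∧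
      Module.Free (LaurentPoly₂ R)ᵐᵒᵖ (C.X n)) :
    IsFinitelyDominated (AddMonoidAlgebra.singleZeroRingHom : R →+* LaurentPoly₂ R) C ↔
      (tensorComplex (edgeHomY R 1) C).Acyclic ∧
      (tensorComplex (edgeHomY R (-1)) C).Acyclic ∧
      (tensorComplex (edgeHomX R 1) C).Acyclic ∧
      (tensorComplex (edgeHomX R (-1)) C).Acyclic ∧
      (tensorComplex (vertexHom R 1 1) C).Acyclic ∧
      (tensorComplex (vertexHom R (-1) (-1)) C).Acyclic ∧
      (tensorComplex (vertexHom R 1 (-1)) C).Acyclic ∧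
      (tensorComplex (vertexHom R (-1) 1) C).Acyclic := by
  obtain ⟨T, _, _, ⟨P⟩⟩ := exists_matrixPresentation C hbdd hfree
  have hD := P.isGradedDifferential
  simp only [P.acyclic_tensorComplex_iff]
  constructor
  · intro h
    have thin := (h.homotopyFinite P).isExactOver_thinHom hD.mul_self
    have edgeY (δ : ℤˣ) : IsExactOver (edgeHomY R δ) P.D :=
      edgeHomY_eq_comp_signs (R := R) δ ▸ (thin (signs 1 δ)).edgeHomY_comp hD
    have edgeX (ε : ℤˣ) : IsExactOver (edgeHomX R ε) P.D :=
      edgeHomX_eq_comp_swapSigns (R := R) ε ▸ (thin (swapSigns ε)).edgeHomY_comp hD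
    have vertex (ε δ : ℤˣ) : IsExactOver (vertexHom R ε δ) P.D :=
      isExactOver_vertexHom_of_thinHom hD (thin _)
    exact ⟨edgeY 1, edgeY (-1), edgeX 1, edgeX (-1), vertex 1 1, vertex (-1) (-1), vertex 1 (-1),
      vertex (-1) 1⟩
  · rintro ⟨hY, hY', hX, hX', h₁, h₂, h₃, h₄⟩
    have vertex (ε δ : ℤˣ) : IsExactOver (vertexHom R ε δ) P.D := by
      rcases Int.units_eq_one_or ε with rfl | rfl <;> rcases Int.units_eq_one_or δ with rfl | rfl
      exacts [h₁, h₃, h₄, h₂]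
    refine HomotopyFinite.isFinitelyDominated P (homotopyFinite_of_isExactOver_thinHom hD
      (fun δ => isExactOver_thinHom_signs hD ?_ fun ε => vertex ε δ)
      fun ε => isExactOver_thinHom_swapSigns hD ?_ (vertex ε))
    · rcases Int.units_eq_one_or δ with rfl | rfl
      exacts [hY, hY']
    · rcases Int.units_eq_one_or ε with rfl | rfl
      exacts [hX, hX']
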